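/- Let $\mathbb D^n=\{z\in\mathbb C^n:|z_k|<1\ \forall k\}$ and $\mathbb T^n=\{z\in\mathbb C^n:|z_k|=1\ \forall k\}$. The Hardy space $\mathbb H^2(\mathbb D^n)$ is the set of holomorphic $f:\mathbb D^n\to\mathbb C$ for which $\|f\|^2=\lim_{r\to1^-}\int_{\mathbb T^n}|f(rw)|^2\,dm_n(w)$ exists and is finite, where $m_n$ is the normalized Lebesgue measure on $\mathbb T^n$. Assume the following. 1. (Holomorphic flow) $F:\mathbb D^n\cup\mathbb T^n\to\mathbb C^n$ is continuous, is holomorphic on $\mathbb D^n$, and generates a flow $(\varphi^t)_{t\ge0}$ on $\mathbb D^n\cup\mathbb T^n$ (that is, $\varphi^0(z)=z$, $\varphi^{t+s}=\varphi^t\circ\varphi^s$, $\frac{d}{dt}\varphi^t(z)=F(\varphi^t(z))$). For all $t\ge 0$, $\varphi^t$ maps $\mathbb D^n$ into $\mathbb D^n$, is holomorphic on $\mathbb D^n$ and is continuous on $\mathbb D^n\cup\mathbb T^n$. 2. (Forward invariance) For every $t>0$ there is $R_t\in(0,1)$ such that $|\varphi^t_k(z)|<R_t$ for all $z\in\mathbb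 T^n$ and all $k$. 3. (Stable hyperbolic equilibrium) $F(0)=0$, the origin is Lyapunov stable, and $\varphi^t(z)\to0$ as $t\to\infty$ for all $z\in\mathbb D^n\cup\mathbb T^n$. The eigenvalues $\lambda_1,\dots,\lambda_n$ of the Jacobian matrix $\mathcal J_F(0)$ are simple and satisfy $\operatorname{Re}\lambda_j<0$. 4. (Nonresonance) $\lambda_j\ne\sum_{l=1}^n m_l\lambda_l$ for all $j$ and all $(m_1,\dots,m_n)\in\mathbb N^n$ with $\sum_l m_l\ge2$. 5. (Output map) The components of the output map $h:\mathbb D^n\to\mathbb C^m$ belong to $\mathbb H^2(\mathbb D^n)$. A linearizing conjugacy $(\Omega,\nu)$ is a biholomorphic map $\nu$ from a connected open neighborhood $\Omega\subseteq\mathbb D^n$ of $0$ onto an open subset of $\mathbb C^n$ with $\nu(0)=0$ and $D\nu(z)F(z)=\mathcal J_F(0)\,\nu(z)$ for $z\in\Omega$; in other words, $y=\nu(x)$ turns $\dot x=F(x)$ into $\dot y=\mathcal J_F(0)y$. Write $A_Ff=\sum_kF_k\,\partial f/\partial z_k$ with domain $D(A_F)=\{f\in\mathbb H^2(\mathbb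 D^n):A_Ff\in\mathbb H^2(\mathbb D^n)\}$, and $K(t)f=f\circ\varphi^t$. Then: (a) A linearizing conjugacy exists. (b) Let $(\Omega,\nu)$ be any linearizing conjugacy and let $1\le j\le n$. There is a $w_j\neq0$ with $w_j^*\mathcal J_F(0)=\lambda_jw_j^*$, and for every such $w_j$ there is a function $\phi_j$ on $\mathbb D^n\cup\mathbb T^n$ (a principal eigenfunction) with $\phi_j=w_j^*\cdot\nu$ on $\Omega$ and $\phi_j(z)=e^{-\lambda_jt}\phi_j(\varphi^t(z))$ for all $z\in\mathbb D^n\cup\mathbb T^n$ and all $t\ge0$ with $\varphi^t(z)\in\Omega$. Every such $\phi_j$ is not identically zero on $\mathbb D^n$, belongs to $\mathbb H^2(\mathbb D^n)$ and to $D(A_F)$, and satisfies $A_F\phi_j=\lambda_j\phi_j$ and $K(t)\phi_j=e^{\lambda_jt}\phi_j$ on $\mathbb D^n$ for all $t\ge0$. (c) More generally, every holomorphic $\phi:\mathbb D^n\to\mathbb C$ with $F\cdot\nabla\phi=\lambda_j\phi$ on $\mathbb D^n$ for some $j$ belongs to $\mathbb H^2(\mathbb D^n)$. -/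

import Mathlib

open scoped Matrix

namespace KoopmanHardy

noncomputable section

/-- The open unit polydisc `𝔻ⁿ`. -/
def polydisc (n : ℕ) : Set (Fin n → ℂ) := {z | ∀ k, ‖z k‖ < 1}

/-- The torus `𝕋ⁿ` (the distinguished boundary of the polydisc). -/
def torus (n : ℕ) : Set (Fin n → ℂ) := {z | ∀ k, ‖z k‖ = 1}

/-- The mean of `|f(r w)|²` over `w ∈ 𝕋ⁿ` for the normalized Lebesgue measure on `𝕋ⁿ`, written
in the angles `w_k = exp (i θ_k)`, `θ ∈ (0, 2π]ⁿ`. -/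
def torusMeanSq {n : ℕ} (f : (Fin n → ℂ) → ℂ) (r : ℝ) : ℝ :=
  ((2 * Real.pi) ^ n)⁻¹ *
    ∫ θ in Set.pi Set.univ (fun _ : Fin n => Set.Ioc (0 : ℝ) (2 * Real.pi)),
      ‖f (fun k => (r : ℂ) * Complex.exp ((θ k : ℂ) * Complex.I))‖ ^ 2

/-- The Hardy space `ℍ²(𝔻ⁿ)`: functions that are holomorphic on `𝔻ⁿ` and for which the limit of
the square means as `r → 1⁻` exists and is finite. Elements are represented by functions on `ℂⁿ`,
of which only the values on `𝔻ⁿ` matter. -/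
def hardySpace (n : ℕ) : Set ((Fin n → ℂ) → ℂ) :=
  {f | DifferentiableOn ℂ f (polydisc n) ∧
    ∃ L : ℝ, Filter.Tendsto (torusMeanSq f) (nhdsWithin 1 (Set.Iio 1)) (nhds L)}

/-- The Koopman generator `A_F f = F · ∇f = ∑ₖ Fₖ ∂f/∂zₖ`. -/
def koopmanGenerator {n : ℕ} (F : (Fin n → ℂ) → (Fin n → ℂ)) (f : (Fin n → ℂ) → ℂ) :
    (Fin n → ℂ) → ℂ :=
  fun z => ∑ k, F z k * fderiv ℂ f z (Pi.single k 1)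

/-- The domain `D(A_F)` of the Koopman generator in `ℍ²(𝔻ⁿ)`. -/
def koopmanGeneratorDomain {n : ℕ} (F : (Fin n → ℂ) → (Fin n → ℂ)) :
    Set ((Fin n → ℂ) → ℂ) :=
  {f | f ∈ hardySpace n ∧ koopmanGenerator F f ∈ hardySpace n}

/-- The Koopman operator `K(t) f = f ∘ φᵗ`. -/
def koopman {n : ℕ} (φ : ℝ → (Fin n → ℂ) → (Fin n → ℂ)) (t : ℝ) (f : (Fin n → ℂ) → ℂ) :
    (Fin n → ℂ) → ℂ :=
  fun z => f (φ t z)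

/-- The Jacobian matrix of `F` at the origin. -/
def jacobianZero {n : ℕ} (F : (Fin n → ℂ) → (Fin n → ℂ)) : Matrix (Fin n) (Fin n) ℂ :=
  Matrix.of fun i k => fderiv ℂ F 0 (Pi.single k 1) i

/-- Holomorphic flow: `F : 𝔻ⁿ ∪ 𝕋ⁿ → ℂⁿ` is holomorphic on `𝔻ⁿ` and continuous up to `𝕋ⁿ`, and
`φ` is the flow generated by `F`. It maps `𝔻ⁿ` into itself, is holomorphic on `𝔻ⁿ`,
and is defined on, and continuous up to, `𝕋ⁿ`. -/
structure HolomorphicFlow {n : ℕ} (F : (Fin n → ℂ) → (Fin n → ℂ))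
    (φ : ℝ → (Fin n → ℂ) → (Fin n → ℂ)) : Prop where
  field_holomorphic : DifferentiableOn ℂ F (polydisc n)
  field_continuous : ContinuousOn F (polydisc n ∪ torus n)
  flow_zero : ∀ z ∈ polydisc n ∪ torus n, φ 0 z = z
  flow_add : ∀ z ∈ polydisc n ∪ torus n, ∀ s t : ℝ, 0 ≤ s → 0 ≤ t →
    φ (t + s) z = φ t (φ s z)
  flow_ode : ∀ z ∈ polydisc n ∪ torus n, ∀ t : ℝ, 0 ≤ t →
    HasDerivWithinAt (fun s => φ s z) (F (φ t z)) (Set.Ici 0) t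
  flow_mapsTo : ∀ t : ℝ, 0 ≤ t → Set.MapsTo (φ t) (polydisc n) (polydisc n)
  flow_holomorphic : ∀ t : ℝ, 0 ≤ t → DifferentiableOn ℂ (φ t) (polydisc n)
  flow_continuous : ∀ t : ℝ, 0 ≤ t → ContinuousOn (φ t) (polydisc n ∪ torus n)

/-- Forward invariance: for `t > 0` the flow maps `𝕋ⁿ` into a polydisc of radius `R_t < 1`. -/
def ForwardInvariant {n : ℕ} (φ : ℝ → (Fin n → ℂ) → (Fin n → ℂ)) : Prop :=
  ∀ t : ℝ, 0 < t → ∃ R ∈ Set.Ioo (0 : ℝ) 1, ∀ z ∈ torus n, ∀ k, ‖φ t z k‖ < R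

/-- Stable hyperbolic equilibrium: the origin is a (Lyapunov) stable equilibrium that attracts
`𝔻ⁿ ∪ 𝕋ⁿ`, and `lam 0, …, lam (n-1)` are the eigenvalues of the Jacobian matrix at the origin,
which are simple and have negative real parts. -/
structure StableHyperbolicEquilibrium {n : ℕ} (F : (Fin n → ℂ) → (Fin n → ℂ))
    (φ : ℝ → (Fin n → ℂ) → (Fin n → ℂ)) (lam : Fin n → ℂ) : Prop where
  equilibrium : F 0 = 0
  stable : ∀ ε : ℝ, 0 < ε → ∃ δ : ℝ, 0 < δ ∧
    ∀ z ∈ polydisc n, ‖z‖ < δ → ∀ t : ℝ, 0 ≤ t → ‖φ t z‖ < ε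
  attracts : ∀ z ∈ polydisc n ∪ torus n,
    Filter.Tendsto (fun t => φ t z) Filter.atTop (nhds 0)
  eigenvalues : (jacobianZero F).charpoly =
    ∏ j, (Polynomial.X - Polynomial.C (lam j))
  simple : Function.Injective lam
  re_neg : ∀ j, (lam j).re < 0

/-- Nonresonance of the eigenvalues. -/
def Nonresonant {n : ℕ} (lam : Fin n → ℂ) : Prop :=
  ∀ m : Fin n → ℕ, 2 ≤ ∑ l, m l → ∀ j, lam j ≠ ∑ l, (m l : ℂ) * lam l

/-- `ν` is a holomorphic conjugacy on the connected open neighborhood `Ω` of the origin between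
the system `x' = F(x)` and the linear system `y' = J_F(0) y`: it is biholomorphic from `Ω` onto
the open set `ν(Ω)`, fixes the origin, and `y = ν(x)` turns `F` into `J_F(0)`. -/
structure LinearizingConjugacy {n : ℕ} (F : (Fin n → ℂ) → (Fin n → ℂ))
    (Ω : Set (Fin n → ℂ)) (ν : (Fin n → ℂ) → (Fin n → ℂ)) : Prop where
  isOpen : IsOpen Ω
  zero_mem : (0 : Fin n → ℂ) ∈ Ω
  connected : IsPreconnected Ω
  subset : Ω ⊆ polydisc n
  holomorphic : DifferentiableOn ℂ ν Ω
  image_open : IsOpen (ν '' Ω)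
  inverse_holomorphic : ∃ μ : (Fin n → ℂ) → (Fin n → ℂ),
    DifferentiableOn ℂ μ (ν '' Ω) ∧ ∀ z ∈ Ω, μ (ν z) = z
  map_zero : ν 0 = 0
  conjugates : ∀ z ∈ Ω, fderiv ℂ ν z (F z) = jacobianZero F *ᵥ ν z

/-- `w` is a left eigenvector of `M` for the eigenvalue `c`: `w* M = c w*` and `w ≠ 0`. -/
def IsLeftEigenvector {n : ℕ} (M : Matrix (Fin n) (Fin n) ℂ) (c : ℂ) (w : Fin n → ℂ) : Prop :=
  w ≠ 0 ∧ star w ᵥ* M = c • star w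

/-- `f` is the principal eigenfunction obtained from the linearizing conjugacy `ν` on `Ω` and the
left eigenvector `w` for the eigenvalue `c`: `f = w* · ν` on `Ω`, extended to `𝔻ⁿ ∪ 𝕋ⁿ` by
`f(z) = e^{-c t} f(φᵗ(z))` for the times `t ≥ 0` at which `φᵗ(z) ∈ Ω`. -/
def IsPrincipalEigenfunction {n : ℕ} (φ : ℝ → (Fin n → ℂ) → (Fin n → ℂ))
    (Ω : Set (Fin n → ℂ)) (ν : (Fin n → ℂ) → (Fin n → ℂ)) (w : Fin n → ℂ) (c : ℂ)
    (f : (Fin n → ℂ) → ℂ) : Prop :=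
  (∀ z ∈ Ω, f z = star w ⬝ᵥ ν z) ∧
  ∀ z ∈ polydisc n ∪ torus n, ∀ t : ℝ, 0 ≤ t → φ t z ∈ Ω →
    f z = Complex.exp (-c * t) * f (φ t z)

end

end KoopmanHardy

/-! For `t > 0` the maximum principle carries the strict bound on `φ t` from the torus to the
polydisc, so `φ t` sends everything into a compact polydisc inside `𝔻ⁿ`. An eigenfunction satisfies
`f = e^{-λ} f ∘ φ 1` on `𝔻ⁿ`; the right side is bounded and continuous up to the torus, so the
square means converge by dominated convergence. Every Hardy space claim rests on this
(`mem_hardySpace_of_flow_eq`).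

The conjugacy is Poincaré's theorem. In the sup norm the polydisc is the unit ball, and the Schwarz
lemma gives `‖φ (k + s) z‖ ≤ R ^ k * ‖z‖` with `R < 1`. Nonresonance makes the homological equation
solvable degree by degree, so a linear eigenfunctional `ℓ j` can be corrected to `p` with `F · ∇p -
λ p = O(‖z‖ ^ N)`. For large `N` the contraction beats the growth of `e^{-λt}`, and `e^{-λt} p ∘ φ
t` converges to a true eigenfunction with linear part `ℓ j`. Together these form a map tangent to
the identity, which the inverse function theorem inverts.

For an arbitrary conjugacy, `w* · ν` is an eigenfunction on `Ω`. It is pulled back along the flow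
from a small ball, which is forward invariant by the Schwarz lemma; the identity theorem then gives
agreement on the connected set `Ω`, which need not be invariant itself. The result is nonzero
because `ν(Ω)` contains a nonzero multiple of `w`. -/

open Filter Topology Metric Set Asymptotics MeasureTheory

/-! ### Holomorphic maps between normed spaces -/

section ComplexAnalysis

variable {E G : Type*} [NormedAddCommGroup E] [NormedSpace ℂ E]
  [NormedAddCommGroup G] [NormedSpace ℂ G]

theorem norm_fderiv_le_of_norm_le_on_ball {f : E → G} {c : E} {r M : ℝ} (hr : 0 < r)
    (hf : DifferentiableOn ℂ f (ball c r)) (hM : ∀ z ∈ ball c r, ‖f z‖ ≤ M) :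
    ‖fderiv ℂ f c‖ ≤ 2 * M / r := by
  refine Complex.norm_fderiv_le_div_of_mapsTo_ball hf (fun z hz => ?_) hr
  rw [mem_closedBall, dist_eq_norm]
  calc ‖f z - f c‖ ≤ ‖f z‖ + ‖f c‖ := norm_sub_le _ _
    _ ≤ M + M := add_le_add (hM z hz) (hM c (mem_ball_self hr))
    _ = 2 * M := by ring

/-- Uniform limits of holomorphic functions between complex normed spaces are holomorphic. -/
theorem differentiableOn_of_tendstoUniformlyOn [CompleteSpace G] {f : ℕ → E → G} {g : E → G}
    {U : Set E} (hU : IsOpen U) (hf : ∀ k, DifferentiableOn ℂ (f k) U)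
    (hg : TendstoUniformlyOn f g atTop U) : DifferentiableOn ℂ g U := by
  intro x hx
  obtain ⟨r, hr, hrU⟩ := Metric.isOpen_iff.1 hU x hx
  have hsub : ∀ y ∈ ball x (r / 2), ball y (r / 2) ⊆ U := fun y hy z hz => hrU (by
    rw [mem_ball] at *
    linarith [dist_triangle z y x])
  -- Cauchy's estimate on balls of radius `r / 2`: a bound `ε * r / 8` on `f k - f m` bounds the
  -- difference of the derivatives by `ε / 2`.
  have hC : UniformCauchySeqOn (fun k => fderiv ℂ (f k)) atTop (ball x (r / 2)) := by
    rw [Metric.uniformCauchySeqOn_iff]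
    intro ε hε
    obtain ⟨N, hN⟩ := Metric.uniformCauchySeqOn_iff.1 hg.uniformCauchySeqOn (ε * r / 8)
      (by positivity)
    refine ⟨N, fun k hk m hm y hy => ?_⟩
    have hd : ∀ i, DifferentiableAt ℂ (f i) y := fun i =>
      (hf i).differentiableAt (hU.mem_nhds (hsub y hy (mem_ball_self (by positivity))))
    rw [dist_eq_norm, ← fderiv_sub (hd k) (hd m)]
    refine (norm_fderiv_le_of_norm_le_on_ball (half_pos hr)
      (((hf k).sub (hf m)).mono (hsub y hy)) (M := ε * r / 8) fun z hz => ?_).trans_lt ?_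
    · have := hN k hk m hm z (hsub y hy hz)
      rw [dist_eq_norm] at this
      exact this.le
    · field_simp
      norm_num
  have hlim : ∀ y ∈ ball x (r / 2), ∃ L, Tendsto (fun k => fderiv ℂ (f k) y) atTop (𝓝 L) :=
    fun y hy => cauchySeq_tendsto_of_complete (hC.cauchySeq hy)
  choose! g' hg' using hlim
  refine (hasFDerivAt_of_tendstoUniformlyOn isOpen_ball
    (f := f) (hC.tendstoUniformlyOn_of_tendsto hg') (fun k y hy => ?_) (fun y hy => ?_)
    (mem_ball_self (half_pos hr))).differentiableAt.differentiableWithinAt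
  · exact ((hf k).differentiableAt
      (hU.mem_nhds (hsub y hy (mem_ball_self (by positivity))))).hasFDerivAt
  · exact hg.tendsto_at (hsub y hy (mem_ball_self (by positivity)))

/-- Quadratic remainder estimate for a bounded holomorphic function. -/
theorem norm_sub_sub_fderiv_le {f : E → G} {c z : E} {r M : ℝ} (hr : 0 < r)
    (hf : DifferentiableOn ℂ f (ball c r)) (hM : ∀ z ∈ ball c r, ‖f z‖ ≤ M)
    (hz : z ∈ ball c r) :
    ‖f z - f c - fderiv ℂ f c (z - c)‖ ≤ 4 * M * (‖z - c‖ / r) ^ 2 := by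
  set h : E → G := fun w => f w - fderiv ℂ f c (w - c) with hh
  have hd : HasFDerivAt f (fderiv ℂ f c) c :=
    (hf.differentiableAt (isOpen_ball.mem_nhds (mem_ball_self hr))).hasFDerivAt
  have hc : h c = f c := by simp [hh]
  have hM0 : 0 ≤ M := (norm_nonneg _).trans (hM c (mem_ball_self hr))
  -- With its linear part removed, the function vanishes to second order at `c` up to a constant, so
  -- the higher-order Schwarz lemma gives the square; `4 * M` is `M + M` plus `2 * M` for the linear
  -- part.
  have key := Complex.dist_le_mul_div_pow_of_mapsTo_ball_of_isLittleO (f := h) (c := c)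
    (z := z) (R₁ := r) (R₂ := 4 * M) (n := 1) ?_ ?_ ?_ hz
  · rw [dist_eq_norm, dist_eq_norm, hc] at key
    refine (le_of_eq ?_).trans key
    congr 1
    simp only [hh]
    abel
  · exact hf.sub (by fun_prop)
  · intro w hw
    rw [mem_closedBall, dist_eq_norm, hc]
    have h1 : ‖fderiv ℂ f c (w - c)‖ ≤ 2 * M := by
      refine ((fderiv ℂ f c).le_opNorm _).trans ?_
      have hw' : ‖w - c‖ ≤ r := by
        rw [mem_ball, dist_eq_norm] at hw
        exact hw.le
      calc ‖fderiv ℂ f c‖ * ‖w - c‖ ≤ 2 * M / r * r := by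
            gcongr
            exact norm_fderiv_le_of_norm_le_on_ball hr hf hM
        _ = 2 * M := by field_simp
    calc ‖h w - f c‖ = ‖f w - f c - fderiv ℂ f c (w - c)‖ := by
          congr 1
          simp only [hh]
          abel
      _ ≤ ‖f w‖ + ‖f c‖ + ‖fderiv ℂ f c (w - c)‖ :=
          (norm_sub_le _ _).trans (by gcongr; exact norm_sub_le _ _)
      _ ≤ M + M + 2 * M := by
          gcongr
          exacts [hM w hw, hM c (mem_ball_self hr)]
      _ = 4 * M := by ring
  · have h1 := hd.isLittleO
    simp only [pow_one]
    rw [← isLittleO_norm_right] at h1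
    refine h1.congr_left fun w => ?_
    simp only [hh]
    rw [sub_self, map_zero, sub_zero]
    abel

/-- The derivative of a holomorphic function, in a fixed direction, is holomorphic. -/
theorem DifferentiableOn.fderiv_apply_complex [CompleteSpace G] {f : E → G} {U : Set E}
    (hU : IsOpen U) (hf : DifferentiableOn ℂ f U) (v : E) :
    DifferentiableOn ℂ (fun z => fderiv ℂ f z v) U := by
  intro x hx
  obtain ⟨r, hr, hrU⟩ : ∃ r > 0, ball x (2 * r) ⊆ U ∧ ∀ z ∈ ball x (2 * r), ‖f z‖ ≤ ‖f x‖ + 1 := by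
    have h1 : ∀ᶠ z in 𝓝 x, z ∈ U ∧ ‖f z‖ < ‖f x‖ + 1 :=
      Filter.Eventually.and (hU.mem_nhds hx) (((hf.differentiableAt (hU.mem_nhds hx)).continuousAt.norm).eventually
        (gt_mem_nhds (lt_add_one _)))
    obtain ⟨r, hr, h⟩ := Metric.eventually_nhds_iff_ball.1 h1
    refine ⟨r / 2, half_pos hr, fun z hz => ?_, fun z hz => ?_⟩
    · exact (h z (by rwa [mul_div_cancel₀ _ two_ne_zero] at hz)).1
    · exact (h z (by rwa [mul_div_cancel₀ _ two_ne_zero] at hz)).2.le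
  obtain ⟨hrU, hM⟩ := hrU
  set M := ‖f x‖ + 1
  have hM0 : 0 ≤ M := by positivity
  have hsub : ∀ y ∈ ball x r, ball y r ⊆ ball x (2 * r) := fun y hy z hz => by
    rw [mem_ball] at *
    linarith [dist_triangle z y x]
  -- The derivative is the limit of difference quotients with step `1 / (K + k)`. The shift by `K`
  -- keeps `y + v / (K + k)` within distance `r` of `y`, and the quadratic remainder makes the
  -- convergence uniform.
  obtain ⟨K, hK⟩ := exists_nat_gt (‖v‖ / r)
  have hK0 : 0 < (K : ℝ) := lt_of_le_of_lt (by positivity) hK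
  have hmem : ∀ k : ℕ, ∀ y : E, y + ((K + k : ℕ) : ℂ)⁻¹ • v ∈ ball y r := fun k y => by
    rw [mem_ball, dist_eq_norm, add_sub_cancel_left, norm_smul, norm_inv, Complex.norm_natCast,
      inv_mul_lt_iff₀ (by push_cast; positivity)]
    rw [div_lt_iff₀ hr] at hK
    push_cast
    nlinarith [k.cast_nonneg (α := ℝ)]
  refine (differentiableOn_of_tendstoUniformlyOn (U := ball x r)
    (f := fun k z => ((K + k : ℕ) : ℂ) • (f (z + ((K + k : ℕ) : ℂ)⁻¹ • v) - f z)) isOpen_ball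
    (fun k => ?_) ?_).differentiableAt (isOpen_ball.mem_nhds (mem_ball_self hr))
      |>.differentiableWithinAt
  · refine DifferentiableOn.const_smul (DifferentiableOn.sub ?_ ?_) _
    · exact hf.comp (by fun_prop) fun y hy => hrU (hsub y hy (hmem k y))
    · exact hf.mono ((ball_subset_ball (by linarith)).trans hrU)
  · have hlim : Tendsto (fun k : ℕ => 4 * M * (‖v‖ / r) ^ 2 * ((K + k : ℕ) : ℝ)⁻¹) atTop (𝓝 0) := by
      rw [← mul_zero (4 * M * (‖v‖ / r) ^ 2)]
      refine Tendsto.const_mul _ (tendsto_inv_atTop_zero.comp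
        (tendsto_natCast_atTop_atTop.comp ?_))
      exact tendsto_atTop_mono (fun k => Nat.le_add_left k K) tendsto_id
    rw [Metric.tendstoUniformlyOn_iff]
    intro ε hε
    filter_upwards [hlim.eventually (gt_mem_nhds hε)] with k hk y hy
    refine lt_of_le_of_lt ?_ hk
    have hKk : (0 : ℝ) < ((K + k : ℕ) : ℝ) := by push_cast; positivity
    have hKk' : ((K + k : ℕ) : ℂ) ≠ 0 := by
      rw [Ne, ← norm_eq_zero, Complex.norm_natCast]
      exact hKk.ne'
    have := norm_sub_sub_fderiv_le hr (hf.mono ((hsub y hy).trans hrU))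
      (fun z hz => hM z (hsub y hy hz)) (hmem k y)
    rw [add_sub_cancel_left, map_smul, norm_smul, norm_inv, Complex.norm_natCast] at this
    rw [dist_comm, dist_eq_norm]
    calc _ = ‖((K + k : ℕ) : ℂ) • (f (y + ((K + k : ℕ) : ℂ)⁻¹ • v) - f y
              - ((K + k : ℕ) : ℂ)⁻¹ • fderiv ℂ f y v)‖ := by
          rw [smul_sub _ _ (((K + k : ℕ) : ℂ)⁻¹ • fderiv ℂ f y v), smul_inv_smul₀ hKk']
      _ ≤ ((K + k : ℕ) : ℝ) * (4 * M * (((K + k : ℕ) : ℝ)⁻¹ * ‖v‖ / r) ^ 2) := by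
          rw [norm_smul, Complex.norm_natCast]
          gcongr
      _ = _ := by
          field_simp

/-- In finite dimension, continuity of the derivative can be tested one direction at a time. This
supplies the smoothness needed by the inverse function theorem. -/
theorem DifferentiableOn.contDiffOn_one_complex [FiniteDimensional ℂ E] [CompleteSpace G]
    {f : E → G} {U : Set E} (hU : IsOpen U) (hf : DifferentiableOn ℂ f U) :
    ContDiffOn ℂ 1 f U := by
  rw [← zero_add (1 : WithTop ℕ∞), contDiffOn_succ_iff_fderiv_of_isOpen hU]
  refine ⟨hf, by simp, ?_⟩
  rw [contDiffOn_clm_apply]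
  intro v
  rw [contDiffOn_zero]
  exact (hf.fderiv_apply_complex hU v).continuousOn

/-- Cauchy's estimate for functions vanishing to a given order. -/
theorem fderiv_isBigO_pow {f : E → G} (hf : ∀ᶠ z in 𝓝 0, DifferentiableAt ℂ f z) {d : ℕ}
    (h : f =O[𝓝 0] fun z => ‖z‖ ^ (d + 1)) :
    fderiv ℂ f =O[𝓝 0] fun z => ‖z‖ ^ d := by
  obtain ⟨C, hC0, hC'⟩ := h.exists_nonneg
  have hC := hC'.bound
  obtain ⟨r, hr, hb⟩ := Metric.eventually_nhds_iff_ball.1 (hf.and hC)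
  refine IsBigO.of_bound (2 * C * 2 ^ (d + 1)) ?_
  filter_upwards [ball_mem_nhds (0 : E) (half_pos hr)] with z hz
  rw [mem_ball_zero_iff] at hz
  have hsub : ∀ w ∈ ball z ‖z‖, w ∈ ball 0 r ∧ ‖w‖ ≤ 2 * ‖z‖ := fun w hw => by
    rw [mem_ball, dist_eq_norm] at hw
    rw [mem_ball_zero_iff]
    have : ‖w‖ ≤ ‖w - z‖ + ‖z‖ := by simpa using norm_add_le (w - z) z
    constructor <;> linarith
  -- Away from the origin Cauchy's estimate is applied on the ball of radius `‖z‖` about `z`. At `z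
  -- = 0` this ball degenerates: for `d = 0` a Lipschitz bound suffices, for `d > 0` the derivative
  -- has to vanish.
  rcases eq_or_ne z 0 with rfl | hz0
  · have hf0 : f 0 = 0 := by simpa using (hb 0 (mem_ball_self hr)).2
    rcases Nat.eq_zero_or_pos d with rfl | hd
    · refine (norm_fderiv_le_of_lip' ℂ hC0 ?_).trans ?_
      · filter_upwards [hC] with w hw
        simpa [hf0] using hw
      · norm_num
        linarith
    · have h0 : HasFDerivAt f (0 : E →L[ℂ] G) 0 := by
        rw [hasFDerivAt_iff_isLittleO_nhds_zero]
        have : (fun z : E => ‖z‖ ^ (d + 1)) =o[𝓝 0] fun z => z := by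
          rw [← isLittleO_norm_right]
          simpa using isLittleO_norm_pow_norm_pow (E' := E) (show 1 < d + 1 by omega)
        simpa [hf0] using h.trans_isLittleO this
      rw [h0.fderiv]
      simp [hd.ne']
  · have hz' : 0 < ‖z‖ := norm_pos_iff.2 hz0
    refine (norm_fderiv_le_of_norm_le_on_ball hz' (fun w hw =>
      (hb w (hsub w hw).1).1.differentiableWithinAt) (M := C * (2 * ‖z‖) ^ (d + 1))
      fun w hw => ?_).trans ?_
    · refine (hb w (hsub w hw).1).2.trans ?_
      rw [norm_pow, norm_norm]
      gcongr
      exact (hsub w hw).2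
    · rw [norm_pow, norm_norm]
      apply le_of_eq
      field_simp
      ring

theorem sub_fderiv_zero_isBigO {f : E → G} (hf : ∀ᶠ z in 𝓝 0, DifferentiableAt ℂ f z)
    (h0 : f 0 = 0) : (fun z => f z - fderiv ℂ f 0 z) =O[𝓝 0] fun z => ‖z‖ ^ 2 := by
  have h1 : ∀ᶠ z in 𝓝 0, ‖f z‖ < 1 :=
    hf.self_of_nhds.continuousAt.norm.eventually (gt_mem_nhds (by simp [h0]))
  obtain ⟨r, hr, hb⟩ := Metric.eventually_nhds_iff_ball.1 (hf.and h1)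
  refine IsBigO.of_bound (4 * 1 / r ^ 2) ?_
  filter_upwards [ball_mem_nhds (0 : E) hr] with z hz
  have := norm_sub_sub_fderiv_le hr (fun w hw => (hb w hw).1.differentiableWithinAt)
    (fun w hw => (hb w hw).2.le) hz
  rw [norm_pow, norm_norm]
  simp only [h0, sub_zero] at this
  refine this.trans (le_of_eq ?_)
  ring

/-- The identity theorem for holomorphic functions on preconnected open sets. -/
theorem eqOn_of_preconnected_of_eventuallyEq_complex [CompleteSpace G] {f g : E → G} {U : Set E}
    (hU : IsOpen U) (hc : IsPreconnected U) (hf : DifferentiableOn ℂ f U)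
    (hg : DifferentiableOn ℂ g U) {z₀ : E} (hz₀ : z₀ ∈ U) (hfg : f =ᶠ[𝓝 z₀] g) :
    EqOn f g U := by
  have hsub : U ⊆ {z | f =ᶠ[𝓝 z] g} := by
    refine hc.subset_of_closure_inter_subset ?_ ⟨z₀, hz₀, hfg⟩ ?_
    · exact isOpen_setOfPred_eventually_nhds
    · rintro z ⟨hz, hzU⟩
      obtain ⟨r, hr, hrU⟩ := Metric.isOpen_iff.1 hU z hzU
      obtain ⟨w, hw, hwr⟩ := Metric.mem_closure_iff.1 hz r hr
      rw [dist_comm] at hwr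
      filter_upwards [ball_mem_nhds z hr] with u hu
      -- Reduction to one variable: the germs of `f` and `g` agree at `w`, and the complex line
      -- through `w` and `u` meets the ball in a convex set, on which the classical identity theorem
      -- passes from `s = 0` to `s = 1`.
      set L : ℂ → E := fun s => w + s • (u - w)
      have hL : Differentiable ℂ L := by fun_prop
      set S : Set ℂ := L ⁻¹' ball z r
      have hS : IsOpen S := isOpen_ball.preimage hL.continuous
      have hSc : IsPreconnected S := by
        apply Convex.isPreconnected
        have h1 : Convex ℝ (ball z r) := by
          let _ : NormedSpace ℝ E := NormedSpace.restrictScalars ℝ ℂ E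
          exact convex_ball z r
        intro a ha b hb s t hs ht hst
        have h2 := h1 ha hb hs ht hst
        have : L (s • a + t • b) = s • L a + t • L b := by
          have e : (s : ℂ) + t = 1 := by exact_mod_cast hst
          have e2 : ∀ (q : ℝ) (x : E), q • x = (q : ℂ) • x := fun q x => rfl
          simp only [L, e2, smul_add, smul_smul, Complex.real_smul, add_smul]
          nth_rw 1 [← one_smul ℂ w, ← e, add_smul]
          abel
        simp only [S, mem_preimage, this]
        exact h2
      have h0 : (0 : ℂ) ∈ S := by simpa [S, L] using hwr
      have h1 : (1 : ℂ) ∈ S := by simpa [S, L] using hu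
      have hd : ∀ {k : E → G}, DifferentiableOn ℂ k U → AnalyticOnNhd ℂ (k ∘ L) S := fun hk =>
        DifferentiableOn.analyticOnNhd (hk.comp hL.differentiableOn fun s hs => hrU hs) hS
      have he : f ∘ L =ᶠ[𝓝 0] g ∘ L := by
        have hw' : f =ᶠ[𝓝 (L 0)] g := by simpa [L] using hw
        exact hL.continuous.continuousAt.eventually hw'
      have := (hd hf).eqOn_of_preconnected_of_eventuallyEq (hd hg) hSc h0 he h1
      simpa [L] using this
  exact fun z hz => (hsub hz).self_of_nhds

end ComplexAnalysis

/-! ### Homogeneous forms and the homological equation -/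

section HomogeneousForms

theorem norm_pow_isBigO_of_le {E : Type*} [NormedAddCommGroup E] {a b : ℕ} (h : a ≤ b) :
    (fun z : E => ‖z‖ ^ b) =O[𝓝 0] fun z => ‖z‖ ^ a := by
  refine IsBigO.of_bound 1 ?_
  filter_upwards [ball_mem_nhds (0 : E) zero_lt_one] with z hz
  rw [mem_ball_zero_iff] at hz
  rw [norm_pow, norm_pow, norm_norm, one_mul]
  exact pow_le_pow_of_le_one (norm_nonneg z) hz.le h

variable {E ι : Type*} [NormedAddCommGroup E] [NormedSpace ℂ E] [Fintype ι]

/-- The monomial `∏ₗ ℓₗ(z) ^ mₗ` in linear functionals `ℓₗ`. -/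
noncomputable def linearMonomial (ℓ : ι → E →L[ℂ] ℂ) (m : ι → ℕ) : E → ℂ :=
  fun z => ∏ l, ℓ l z ^ m l

/-- Forms of degree `d` in the linear functionals `ℓₗ`. -/
noncomputable def homogeneousForms (ℓ : ι → E →L[ℂ] ℂ) (d : ℕ) : Submodule ℂ (E → ℂ) :=
  Submodule.span ℂ (linearMonomial ℓ '' {m | ∑ l, m l = d})

variable {ℓ : ι → E →L[ℂ] ℂ} {d : ℕ} {q : E → ℂ}

theorem linearMonomial_mem {m : ι → ℕ} (hm : ∑ l, m l = d) :
    linearMonomial ℓ m ∈ homogeneousForms ℓ d :=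
  Submodule.subset_span ⟨m, hm, rfl⟩

theorem functional_mul_mem_homogeneousForms (l : ι) (hq : q ∈ homogeneousForms ℓ d) :
    (fun z => ℓ l z * q z) ∈ homogeneousForms ℓ (d + 1) := by
  classical
  induction hq using Submodule.span_induction with
  | mem q h =>
    obtain ⟨m, hm, rfl⟩ := h
    have : (fun z => ℓ l z * linearMonomial ℓ m z) = linearMonomial ℓ (m + Pi.single l 1) := by
      funext z
      simp only [linearMonomial, Pi.add_apply, pow_add, Finset.prod_mul_distrib]
      rw [mul_comm, Finset.prod_eq_single_of_mem
        (f := fun k => ℓ k z ^ (Pi.single l 1 : ι → ℕ) k) l (Finset.mem_univ l)]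
      · simp
      · intro k _ hk
        simp [hk]
    rw [this]
    refine linearMonomial_mem ?_
    simp only [Pi.add_apply, Finset.sum_add_distrib, Finset.sum_pi_single', Finset.mem_univ,
      if_true]
    exact congrArg (· + 1) hm
  | zero =>
    simp only [Pi.zero_apply, mul_zero]
    exact Submodule.zero_mem _
  | add f g _ _ hf hg =>
    simp only [Pi.add_apply, mul_add]
    exact Submodule.add_mem _ hf hg
  | smul a f _ hf =>
    simp only [Pi.smul_apply, mul_smul_comm]
    exact Submodule.smul_mem _ a hf

theorem homogeneousForms_smul (hq : q ∈ homogeneousForms ℓ d) (s : ℂ) (z : E) :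
    q (s • z) = s ^ d * q z := by
  induction hq using Submodule.span_induction with
  | mem q h =>
    obtain ⟨m, hm, rfl⟩ := h
    simp only [linearMonomial, map_smul, smul_eq_mul, mul_pow, Finset.prod_mul_distrib]
    rw [Finset.prod_pow_eq_pow_sum, show ∑ l, m l = d from hm]
  | zero => simp
  | add f g _ _ hf hg => simp only [Pi.add_apply, hf, hg, mul_add]
  | smul a f _ hf =>
    simp only [Pi.smul_apply, hf, smul_eq_mul]
    ring

theorem differentiable_of_mem_homogeneousForms (hq : q ∈ homogeneousForms ℓ d) :
    Differentiable ℂ q := by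
  induction hq using Submodule.span_induction with
  | mem q h =>
    obtain ⟨m, hm, rfl⟩ := h
    unfold linearMonomial
    fun_prop
  | zero => exact differentiable_const 0
  | add f g _ _ hf hg => exact hf.add hg
  | smul a f _ hf => exact hf.const_smul a

theorem isBigO_of_mem_homogeneousForms (hq : q ∈ homogeneousForms ℓ d) :
    q =O[𝓝 0] fun z => ‖z‖ ^ d := by
  induction hq using Submodule.span_induction with
  | mem q h =>
    obtain ⟨m, hm, rfl⟩ := h
    have : (fun z : E => ‖z‖ ^ d) = fun z => ∏ l, ‖z‖ ^ m l := by
      funext z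
      rw [Finset.prod_pow_eq_pow_sum, show ∑ l, m l = d from hm]
    rw [this]
    exact IsBigO.finsetProd fun l _ => ((ℓ l).isBigO_id _).norm_right.pow _
  | zero => exact isBigO_zero _ _
  | add f g _ _ hf hg => exact hf.add hg
  | smul a f _ hf => exact hf.const_smul_left a

/-- The leading Taylor form of a holomorphic function vanishing to order `d`. -/
theorem exists_homogeneousForm_sub_isBigO {b : ι → E} (hb : ∀ z, ∑ l, ℓ l z • b l = z) (d : ℕ) :
    ∀ {g : E → ℂ}, (∀ᶠ z in 𝓝 0, DifferentiableAt ℂ g z) → g =O[𝓝 0] (fun z => ‖z‖ ^ d) →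
      ∃ q ∈ homogeneousForms ℓ d, (fun z => g z - q z) =O[𝓝 0] fun z => ‖z‖ ^ (d + 1) := by
  induction d with
  | zero =>
    intro g hg _
    refine ⟨g 0 • linearMonomial ℓ 0, Submodule.smul_mem _ _ (linearMonomial_mem (by simp)), ?_⟩
    have := hg.self_of_nhds.hasFDerivAt.isBigO_sub.norm_right
    simpa [linearMonomial] using this
  | succ d ih =>
    intro g hg hgO
    obtain ⟨r, hr, hgr⟩ := Metric.eventually_nhds_iff_ball.1 hg
    have hgd : DifferentiableOn ℂ g (ball 0 r) := fun z hz => (hgr z hz).differentiableWithinAt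
    have hD := fderiv_isBigO_pow hg hgO
    have key : ∀ l, ∃ q ∈ homogeneousForms ℓ d,
        (fun z => fderiv ℂ g z (b l) - q z) =O[𝓝 0] fun z => ‖z‖ ^ (d + 1) := by
      intro l
      refine ih ?_ ?_
      · filter_upwards [ball_mem_nhds (0 : E) hr] with z hz
        exact (hgd.fderiv_apply_complex isOpen_ball (b l)).differentiableAt
          (isOpen_ball.mem_nhds hz)
      · refine IsBigO.trans (IsBigO.of_bound ‖b l‖ (Eventually.of_forall fun z => ?_)) hD
        rw [mul_comm]
        exact (fderiv ℂ g z).le_opNorm _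
    choose q hq hqO using key
    -- Euler's identity recovers a form of degree `d + 1` from its partial derivatives, whose
    -- leading forms are the `q l`.
    set Q : E → ℂ := ((d + 1 : ℕ) : ℂ)⁻¹ • ∑ l, fun z => ℓ l z * q l z with hQ
    have hd0 : ((d + 1 : ℕ) : ℂ) ≠ 0 := Nat.cast_ne_zero.2 (Nat.succ_ne_zero d)
    have hQz : ∀ z, ((d + 1 : ℕ) : ℂ) * Q z = ∑ l, ℓ l z * q l z := fun z => by
      simp only [hQ, Pi.smul_apply, Finset.sum_apply, smul_eq_mul]
      rw [mul_inv_cancel_left₀ hd0]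
    refine ⟨Q, Submodule.smul_mem _ _ (Submodule.sum_mem _ fun l _ =>
      functional_mul_mem_homogeneousForms l (hq l)), ?_⟩
    have hsum : (fun z => ∑ l, ‖fderiv ℂ g z (b l) - q l z‖) =O[𝓝 0] fun z => ‖z‖ ^ (d + 1) :=
      IsBigO.fun_sum fun l _ => (hqO l).norm_left
    obtain ⟨C, hC0, hC⟩ := hsum.exists_nonneg
    obtain ⟨ρ, hρ, hρb⟩ := Metric.eventually_nhds_iff_ball.1 (hg.and hC.bound)
    refine IsBigO.of_bound ((∑ l, ‖ℓ l‖) * C) ?_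
    filter_upwards [ball_mem_nhds (0 : E) hρ] with z hz
    have hg0 : g 0 = 0 := by
      obtain ⟨B, hB⟩ := hgO.bound
      simpa using hB.self_of_nhds
    have hmem : ∀ s ∈ closedBall (0 : ℂ) 1, s • z ∈ ball (0 : E) ρ ∧ ‖s • z‖ ≤ ‖z‖ := by
      intro s hs
      rw [mem_closedBall_zero_iff] at hs
      have : ‖s • z‖ ≤ ‖z‖ := by
        rw [norm_smul]
        exact mul_le_of_le_one_left (norm_nonneg _) hs
      rw [mem_ball_zero_iff] at *
      exact ⟨this.trans_lt hz, this⟩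
    -- The mean value inequality is applied to `g (s • z) - s ^ (d + 1) * Q z` between `s = 0` and
    -- `s = 1`; the derivative contains only the remainders of the partial derivatives.
    have hder : ∀ s ∈ closedBall (0 : ℂ) 1,
        HasDerivWithinAt (fun s : ℂ => g (s • z) - s ^ (d + 1) * Q z)
          (∑ l, ℓ l z * (fderiv ℂ g (s • z) (b l) - q l (s • z))) (closedBall 0 1) s := by
      intro s hs
      have h1 : HasDerivAt (fun s : ℂ => g (s • z)) (fderiv ℂ g (s • z) z) s := by
        have h2 : HasDerivAt (fun s : ℂ => s • z) z s := by
          simpa using (hasDerivAt_id s).smul_const z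
        exact (hρb _ (hmem s hs).1).1.hasFDerivAt.comp_hasDerivAt s h2
      have h3 := (h1.sub ((hasDerivAt_pow (d + 1) s).mul_const (Q z))).hasDerivWithinAt
        (s := closedBall (0 : ℂ) 1)
      refine h3.congr_deriv ?_
      have h4 : fderiv ℂ g (s • z) z = ∑ l, ℓ l z * fderiv ℂ g (s • z) (b l) := by
        conv_lhs => enter [2]; rw [← hb z]
        simp [map_sum]
      rw [h4, Nat.add_sub_cancel, mul_right_comm, hQz, Finset.sum_mul, ← Finset.sum_sub_distrib]
      refine Finset.sum_congr rfl fun l _ => ?_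
      rw [homogeneousForms_smul (hq l)]
      ring
    have hbound : ∀ s ∈ closedBall (0 : ℂ) 1,
        ‖∑ l, ℓ l z * (fderiv ℂ g (s • z) (b l) - q l (s • z))‖ ≤
          ((∑ l, ‖ℓ l‖) * C) * ‖z‖ ^ (d + 2) := by
      intro s hs
      have h1 : ∀ l, ‖fderiv ℂ g (s • z) (b l) - q l (s • z)‖ ≤ C * ‖z‖ ^ (d + 1) := by
        intro l
        have h2 := (hρb _ (hmem s hs).1).2
        rw [norm_pow, norm_norm, Real.norm_of_nonneg (Finset.sum_nonneg fun _ _ => norm_nonneg _)]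
          at h2
        refine (Finset.single_le_sum (f := fun l => ‖fderiv ℂ g (s • z) (b l) - q l (s • z)‖)
          (fun _ _ => norm_nonneg _) (Finset.mem_univ l)).trans (h2.trans ?_)
        gcongr
        exact (hmem s hs).2
      calc _ ≤ ∑ l, ‖ℓ l z * (fderiv ℂ g (s • z) (b l) - q l (s • z))‖ := norm_sum_le _ _
        _ ≤ ∑ l, ‖ℓ l‖ * ‖z‖ * (C * ‖z‖ ^ (d + 1)) := by
            refine Finset.sum_le_sum fun l _ => ?_
            rw [norm_mul]
            gcongr
            exacts [(ℓ l).le_opNorm z, h1 l]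
        _ = _ := by
            rw [← Finset.sum_mul, ← Finset.sum_mul]
            ring
    have := Convex.norm_image_sub_le_of_norm_hasDerivWithin_le hder hbound
      (convex_closedBall 0 1) (mem_closedBall_self zero_le_one)
      (show (1 : ℂ) ∈ closedBall 0 1 by simp)
    simpa [hg0] using this

/-- The derivation `η ↦ Dη · A` is diagonal on monomials in the `ℓ l`, with eigenvalues `∑ m l * lam
l`. Nonresonance keeps `c` away from these in degree `d`, so one divides by the difference. -/
theorem exists_homological_solution {A : E →L[ℂ] E} {lam : ι → ℂ}
    (hA : ∀ l z, ℓ l (A z) = lam l * ℓ l z) {c : ℂ}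
    (hc : ∀ m : ι → ℕ, ∑ l, m l = d → c ≠ ∑ l, (m l : ℂ) * lam l)
    (hq : q ∈ homogeneousForms ℓ d) :
    ∃ η ∈ homogeneousForms ℓ d, ∀ z, fderiv ℂ η z (A z) - c * η z = q z := by
  induction hq using Submodule.span_induction with
  | mem q h =>
    obtain ⟨m, hm, rfl⟩ := h
    have hmono : ∀ (S : Finset ι) (z : E),
        fderiv ℂ (fun z => ∏ l ∈ S, ℓ l z ^ m l) z (A z) =
          (∑ l ∈ S, (m l : ℂ) * lam l) * ∏ l ∈ S, ℓ l z ^ m l := by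
      classical
      intro S z
      induction S using Finset.induction_on with
      | empty => simp
      | insert a S ha ih =>
        simp only [Finset.prod_insert ha, Finset.sum_insert ha]
        rw [fderiv_fun_mul (by fun_prop) (by fun_prop)]
        have hpow : fderiv ℂ (fun z => ℓ a z ^ m a) z (A z) = m a * lam a * ℓ a z ^ m a := by
          rw [fderiv_fun_pow _ (by fun_prop)]
          simp only [ContinuousLinearMap.fderiv, _root_.smul_apply, hA, nsmul_eq_mul, smul_eq_mul]
          rcases Nat.eq_zero_or_pos (m a) with h0 | h0
          · simp [h0]
          · obtain ⟨k, hk⟩ := Nat.exists_eq_succ_of_ne_zero h0.ne'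
            rw [hk, Nat.succ_eq_add_one, Nat.add_sub_cancel]
            ring
        simp only [_root_.add_apply, _root_.smul_apply, ih, hpow, smul_eq_mul]
        ring
    have hne : ∑ l, (m l : ℂ) * lam l - c ≠ 0 := sub_ne_zero.2 (hc m hm).symm
    refine ⟨(∑ l, (m l : ℂ) * lam l - c)⁻¹ • linearMonomial ℓ m,
      Submodule.smul_mem _ _ (linearMonomial_mem hm), fun z => ?_⟩
    have hd := differentiable_of_mem_homogeneousForms (linearMonomial_mem (ℓ := ℓ) hm)
    rw [fderiv_const_smul (hd z)]
    have := hmono Finset.univ z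
    simp only [_root_.smul_apply, Pi.smul_apply, smul_eq_mul]
    change _ * fderiv ℂ (fun z => ∏ l, ℓ l z ^ m l) z (A z) - _ = _
    rw [this]
    change _ * (_ * linearMonomial ℓ m z) - _ = _
    field_simp
  | zero => exact ⟨0, Submodule.zero_mem _, fun z => by simp⟩
  | add f g _ _ hf hg =>
    obtain ⟨η, hη, h1⟩ := hf
    obtain ⟨ξ, hξ, h2⟩ := hg
    refine ⟨η + ξ, Submodule.add_mem _ hη hξ, fun z => ?_⟩
    rw [fderiv_add (differentiable_of_mem_homogeneousForms hη z)
      (differentiable_of_mem_homogeneousForms hξ z), Pi.add_apply, Pi.add_apply, ← h1, ← h2]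
    simp only [_root_.add_apply]
    ring
  | smul a f _ hf =>
    obtain ⟨η, hη, h1⟩ := hf
    refine ⟨a • η, Submodule.smul_mem _ _ hη, fun z => ?_⟩
    rw [fderiv_const_smul (differentiable_of_mem_homogeneousForms hη z), Pi.smul_apply,
      Pi.smul_apply, ← h1]
    simp only [_root_.smul_apply, smul_eq_mul]
    ring

/-- In the absence of resonances, a linear eigenfunctional of the linear part of a holomorphic
vector field can be corrected to an eigenfunction modulo terms of arbitrarily high order. -/
theorem exists_approximate_eigenfunction {b : ι → E} (hb : ∀ z, ∑ l, ℓ l z • b l = z)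
    {F : E → E} (hF : ∀ᶠ z in 𝓝 0, DifferentiableAt ℂ F z) (hF0 : F 0 = 0) {lam : ι → ℂ}
    (hA : ∀ l z, ℓ l (fderiv ℂ F 0 z) = lam l * ℓ l z) (j : ι)
    (hc : ∀ m : ι → ℕ, 2 ≤ ∑ l, m l → lam j ≠ ∑ l, (m l : ℂ) * lam l) (N : ℕ) :
    ∃ p : E → ℂ, Differentiable ℂ p ∧ (fun z => p z - ℓ j z) =O[𝓝 0] (fun z => ‖z‖ ^ 2) ∧
      (fun z => fderiv ℂ p z (F z) - lam j * p z) =O[𝓝 0] fun z => ‖z‖ ^ (N + 2) := by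
  have hFA := sub_fderiv_zero_isBigO hF hF0
  induction N with
  | zero =>
    refine ⟨ℓ j, (ℓ j).differentiable, by simpa using isBigO_zero _ _, ?_⟩
    refine ((ℓ j).isBigO_comp (fun z => F z - fderiv ℂ F 0 z) (𝓝 0) |>.trans hFA).congr_left
      fun z => ?_
    rw [(ℓ j).fderiv, map_sub, hA]
  | succ N ih =>
    obtain ⟨p, hp, hp2, hpN⟩ := ih
    have hg : ∀ᶠ z in 𝓝 0, DifferentiableAt ℂ (fun z => fderiv ℂ p z (F z) - lam j * p z) z := by
      filter_upwards [hF] with z hz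
      have h1 : (fun z => fderiv ℂ p z (F z)) = fun z => ∑ l, ℓ l (F z) * fderiv ℂ p z (b l) := by
        funext z
        conv_lhs => rw [← hb (F z)]
        simp [map_sum]
      refine DifferentiableAt.sub ?_ ((hp z).const_mul _)
      rw [h1]
      refine DifferentiableAt.fun_sum fun l _ => DifferentiableAt.mul ?_ ?_
      · exact (ℓ l).differentiableAt.comp z hz
      · exact (hp.differentiableOn.fderiv_apply_complex isOpen_univ (b l)).differentiableAt
          univ_mem
    -- The leading form `q` of the error is cancelled by solving the homological equation for `-q`.
    -- Replacing `F` by its linear part costs `Dη (F - A) = O(‖z‖ ^ (N + 1) * ‖z‖ ^ 2)`, which has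
    -- the required higher order.
    obtain ⟨q, hq, hqO⟩ := exists_homogeneousForm_sub_isBigO hb (N + 2) hg hpN
    obtain ⟨η, hη, hηq⟩ := exists_homological_solution hA
      (fun m hm => hc m (by omega)) (Submodule.neg_mem _ hq)
    have hηd := differentiable_of_mem_homogeneousForms hη
    have hηO := isBigO_of_mem_homogeneousForms hη
    have hDη := fderiv_isBigO_pow (Eventually.of_forall fun z => hηd z) (d := N + 1) hηO
    refine ⟨p + η, hp.add hηd, ?_, ?_⟩
    · have h2 : η =O[𝓝 0] fun z => ‖z‖ ^ 2 :=
        hηO.trans (norm_pow_isBigO_of_le (by omega))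
      refine (hp2.add h2).congr_left fun z => ?_
      simp only [Pi.add_apply]
      ring
    · have h3 : (fun z => fderiv ℂ η z (F z - fderiv ℂ F 0 z)) =O[𝓝 0]
          fun z => ‖z‖ ^ (N + 1 + 2) := by
        have h4 := hDη.norm_left.mul hFA.norm_left
        refine (IsBigO.of_bound 1 (Eventually.of_forall fun z => ?_)).trans
          (h4.congr_right fun z => ?_)
        · rw [one_mul, Real.norm_of_nonneg (by positivity)]
          exact (fderiv ℂ η z).le_opNorm _
        · rw [← pow_add]
      refine (hqO.add h3).congr_left fun z => ?_
      have h5 := hηq z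
      rw [Pi.neg_apply] at h5
      rw [fderiv_add (hp z) (hηd z), Pi.add_apply, _root_.add_apply, map_sub]
      linear_combination -h5

end HomogeneousForms

/-! ### Function theory on the polydisc -/

namespace KoopmanHardy

variable {n : ℕ} {F : (Fin n → ℂ) → (Fin n → ℂ)} {φ : ℝ → (Fin n → ℂ) → (Fin n → ℂ)}
  {lam : Fin n → ℂ}

theorem polydisc_eq_ball (n : ℕ) : polydisc n = ball 0 1 := by
  ext z
  rw [mem_ball_zero_iff, pi_norm_lt_iff one_pos]
  rfl

theorem isOpen_polydisc (n : ℕ) : IsOpen (polydisc n) := polydisc_eq_ball n ▸ isOpen_ball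

theorem mem_polydisc_iff {z : Fin n → ℂ} : z ∈ polydisc n ↔ ‖z‖ < 1 := by
  rw [polydisc_eq_ball, mem_ball_zero_iff]

theorem zero_mem_polydisc (n : ℕ) : (0 : Fin n → ℂ) ∈ polydisc n := by
  simp [mem_polydisc_iff]

theorem smul_mem_polydisc {w : Fin n → ℂ} (hw : w ∈ torus n) {r : ℝ} (h0 : 0 ≤ r) (h1 : r < 1) :
    (r : ℂ) • w ∈ polydisc n := fun k => by
  rw [Pi.smul_apply, norm_smul, hw k, mul_one, Complex.norm_real, Real.norm_of_nonneg h0]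
  exact h1

theorem isCompact_torus (n : ℕ) : IsCompact (torus n) := by
  have : torus n = Set.pi univ fun _ => sphere (0 : ℂ) 1 := by
    ext z
    simp [torus]
  rw [this]
  exact isCompact_univ_pi fun _ => isCompact_sphere _ _

/-- The maximum principle for a polydisc and its distinguished boundary. -/
theorem exists_norm_eq_norm_le {f : (Fin n → ℂ) → ℂ} (hf : DifferentiableOn ℂ f (polydisc n))
    {r : ℝ} (h0 : 0 < r) (h1 : r < 1) {z : Fin n → ℂ} (hz : ∀ k, ‖z k‖ ≤ r) :
    ∃ w : Fin n → ℂ, (∀ k, ‖w k‖ = r) ∧ ‖f z‖ ≤ ‖f w‖ := by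
  -- The coordinates are pushed to the circle of radius `r` one at a time, each by the one-variable
  -- maximum principle.
  suffices ∀ S : Finset (Fin n), ∃ w : Fin n → ℂ,
      (∀ k ∈ S, ‖w k‖ = r) ∧ (∀ k, ‖w k‖ ≤ r) ∧ ‖f z‖ ≤ ‖f w‖ by
    obtain ⟨w, hw, -, h⟩ := this Finset.univ
    exact ⟨w, fun k => hw k (Finset.mem_univ k), h⟩
  intro S
  induction S using Finset.induction_on with
  | empty => exact ⟨z, by simp, hz, le_rfl⟩
  | insert a S ha ih =>
    obtain ⟨w, hwS, hw, hzw⟩ := ih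
    have hmem : ∀ s ∈ closedBall (0 : ℂ) r, ∀ k, ‖Function.update w a s k‖ ≤ r := by
      intro s hs k
      rw [mem_closedBall_zero_iff] at hs
      rcases eq_or_ne k a with rfl | hk
      · simpa using hs
      · simpa [hk] using hw k
    have hd : DifferentiableOn ℂ (fun s => f (Function.update w a s)) (closedBall 0 r) := by
      refine hf.comp (fun s _ => ?_) fun s hs k => (hmem s hs k).trans_lt h1
      exact (hasFDerivAt_update w s).differentiableAt.differentiableWithinAt
    obtain ⟨s, hs, hmax⟩ := Complex.exists_mem_frontier_isMaxOn_norm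
      (U := ball (0 : ℂ) r) isBounded_ball (nonempty_ball.2 h0)
      ((closure_ball (0 : ℂ) h0.ne' ▸ hd).diffContOnCl)
    rw [frontier_ball _ h0.ne', mem_sphere_zero_iff_norm] at hs
    rw [closure_ball _ h0.ne'] at hmax
    refine ⟨Function.update w a s, fun k hk => ?_,
      hmem s (mem_closedBall_zero_iff.2 hs.le), hzw.trans ?_⟩
    · rcases eq_or_ne k a with rfl | hka
      · simpa using hs
      · rw [Function.update_of_ne hka]
        exact hwS k (Finset.mem_of_mem_insert_of_ne hk hka)
    · have := hmax (mem_closedBall_zero_iff.2 (hw a))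
      simpa using this

/-- The maximum principle for functions continuous up to the torus. -/
theorem exists_mem_torus_norm_le {f : (Fin n → ℂ) → ℂ} (hf : DifferentiableOn ℂ f (polydisc n))
    (hc : ContinuousOn f (polydisc n ∪ torus n)) {z : Fin n → ℂ} (hz : z ∈ polydisc n) :
    ∃ w ∈ torus n, ‖f z‖ ≤ ‖f w‖ := by
  rw [mem_polydisc_iff] at hz
  -- Continuity is available only on the polydisc and the torus, not on the rest of the boundary.
  -- Hence maximizers are taken on tori of radii `r k → 1`, and compactness of the torus gives the
  -- limit point.
  obtain ⟨r, -, hr, hlim⟩ := exists_seq_strictMono_tendsto' (show max 0 ‖z‖ < (1 : ℝ) by simp [hz])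
  have hr0 : ∀ k, 0 < r k := fun k => (le_max_left _ _).trans_lt (hr k).1
  have hex : ∀ k, ∃ w ∈ torus n, ‖f z‖ ≤ ‖f ((r k : ℂ) • w)‖ := by
    intro k
    obtain ⟨w, hw, h⟩ := exists_norm_eq_norm_le hf (hr0 k) (hr k).2 (z := z) fun i =>
      (norm_le_pi_norm z i).trans ((le_max_right _ _).trans (hr k).1.le)
    have hk : (r k : ℂ) ≠ 0 := by exact_mod_cast (hr0 k).ne'
    refine ⟨(r k : ℂ)⁻¹ • w, fun i => ?_, by rwa [smul_inv_smul₀ hk]⟩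
    rw [Pi.smul_apply, norm_smul, hw i, norm_inv, Complex.norm_real,
      Real.norm_of_nonneg (hr0 k).le, inv_mul_cancel₀ (hr0 k).ne']
  choose w hw hfw using hex
  obtain ⟨u, hu, ψ, hψ, hwu⟩ := (isCompact_torus n).tendsto_subseq hw
  refine ⟨u, hu, ?_⟩
  have h1 : Tendsto (fun k => (r (ψ k) : ℂ) • w (ψ k)) atTop (𝓝[polydisc n ∪ torus n] u) := by
    refine tendsto_nhdsWithin_iff.2 ⟨?_, Eventually.of_forall fun k =>
      Or.inl (smul_mem_polydisc (hw _) (hr0 _).le (hr _).2)⟩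
    have h2 : Tendsto (fun k => (r (ψ k) : ℂ)) atTop (𝓝 1) := by
      have := (Complex.continuous_ofReal.tendsto 1).comp (hlim.comp hψ.tendsto_atTop)
      simpa [Function.comp_def] using this
    simpa using h2.smul hwu
  exact ge_of_tendsto ((hc u (Or.inr hu)).norm.tendsto.comp h1)
    (Eventually.of_forall fun k => hfw (ψ k))

theorem koopmanGenerator_apply (F : (Fin n → ℂ) → (Fin n → ℂ)) (f : (Fin n → ℂ) → ℂ)
    (z : Fin n → ℂ) : koopmanGenerator F f z = fderiv ℂ f z (F z) := by
  have h : F z = ∑ k, F z k • (Pi.single k 1 : Fin n → ℂ) := by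
    conv_lhs => rw [pi_eq_sum_univ' (F z)]
  conv_rhs => rw [h]
  simp [koopmanGenerator, map_sum]

theorem jacobianZero_mulVec (F : (Fin n → ℂ) → (Fin n → ℂ)) (v : Fin n → ℂ) :
    jacobianZero F *ᵥ v = fderiv ℂ F 0 v := by
  have h : jacobianZero F = LinearMap.toMatrix' (fderiv ℂ F 0).toLinearMap := by
    ext i k
    simp [jacobianZero, LinearMap.toMatrix'_apply]
  rw [h, LinearMap.toMatrix'_mulVec]
  rfl

/-! ### Contraction by the flow and differentiation along orbits -/

/-- The forward-invariance assumption, combined with the maximum principle. -/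
theorem exists_norm_flow_le (hflow : HolomorphicFlow F φ) (hinv : ForwardInvariant φ)
    {t : ℝ} (ht : 0 < t) :
    ∃ R ∈ Ioo (0 : ℝ) 1, ∀ z ∈ polydisc n ∪ torus n, ‖φ t z‖ ≤ R := by
  obtain ⟨R, hR, h⟩ := hinv t ht
  refine ⟨R, hR, fun z hz => (pi_norm_le_iff_of_nonneg hR.1.le).2 fun k => ?_⟩
  rcases hz with hz | hz
  · obtain ⟨w, hw, hzw⟩ := exists_mem_torus_norm_le
      (differentiableOn_pi.1 (hflow.flow_holomorphic t ht.le) k)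
      (continuousOn_pi.1 (hflow.flow_continuous t ht.le) k) hz
    exact hzw.trans (h w hw k).le
  · exact (h z hz k).le

theorem flow_mem_polydisc (hflow : HolomorphicFlow F φ) (hinv : ForwardInvariant φ)
    {t : ℝ} (ht : 0 < t) {z : Fin n → ℂ} (hz : z ∈ polydisc n ∪ torus n) : φ t z ∈ polydisc n := by
  obtain ⟨R, hR, h⟩ := exists_norm_flow_le hflow hinv ht
  exact mem_polydisc_iff.2 ((h z hz).trans_lt hR.2)

theorem flow_mem (hflow : HolomorphicFlow F φ) (hinv : ForwardInvariant φ)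
    {t : ℝ} (ht : 0 ≤ t) {z : Fin n → ℂ} (hz : z ∈ polydisc n ∪ torus n) :
    φ t z ∈ polydisc n ∪ torus n := by
  rcases ht.eq_or_lt with rfl | ht
  · rwa [hflow.flow_zero z hz]
  · exact Or.inl (flow_mem_polydisc hflow hinv ht hz)

/-- Lyapunov stability applied to the point `0` itself bounds its orbit by every `ε`, so no
uniqueness theorem for the differential equation is needed. -/
theorem flow_apply_zero (hstable : StableHyperbolicEquilibrium F φ lam) {t : ℝ} (ht : 0 ≤ t) :
    φ t 0 = 0 := by
  rw [← norm_eq_zero]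
  refine le_antisymm (le_of_forall_pos_le_add fun ε hε => ?_) (norm_nonneg _)
  obtain ⟨δ, hδ, h⟩ := hstable.stable ε hε
  rw [zero_add]
  exact (h 0 (zero_mem_polydisc n) (by simpa using hδ) t ht).le

theorem norm_flow_le (hflow : HolomorphicFlow F φ)
    (hstable : StableHyperbolicEquilibrium F φ lam) {t : ℝ} (ht : 0 ≤ t) {z : Fin n → ℂ}
    (hz : z ∈ polydisc n) : ‖φ t z‖ ≤ ‖z‖ := by
  refine Complex.norm_le_norm_of_mapsTo_ball (R := 1) ?_ ?_ (flow_apply_zero hstable ht)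
    (mem_polydisc_iff.1 hz)
  · rw [← polydisc_eq_ball]
    exact hflow.flow_holomorphic t ht
  · rw [← polydisc_eq_ball]
    exact fun w hw => mem_closedBall_zero_iff.2
      (mem_polydisc_iff.1 (hflow.flow_mapsTo t ht hw)).le

/-- By the Schwarz lemma the flow contracts the polydisc exponentially. -/
theorem exists_norm_flow_add_le (hflow : HolomorphicFlow F φ) (hinv : ForwardInvariant φ)
    (hstable : StableHyperbolicEquilibrium F φ lam) :
    ∃ R ∈ Ioo (0 : ℝ) 1, ∀ z ∈ polydisc n, ∀ (k : ℕ) (s : ℝ), 0 ≤ s →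
      ‖φ (k + s) z‖ ≤ R ^ k * ‖z‖ := by
  obtain ⟨R, hR, hRφ⟩ := exists_norm_flow_le hflow hinv one_pos
  have hstep : ∀ z ∈ polydisc n, ‖φ 1 z‖ ≤ R * ‖z‖ := by
    intro z hz
    have h0 := flow_apply_zero hstable (zero_le_one (α := ℝ))
    have := Complex.dist_le_div_mul_dist_of_mapsTo_ball (f := φ 1) (c := 0) (R₁ := 1) (R₂ := R)
      (z := z) ?_ ?_ ?_
    · simpa [h0] using this
    · rw [← polydisc_eq_ball]
      exact hflow.flow_holomorphic 1 zero_le_one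
    · rw [← polydisc_eq_ball, h0]
      exact fun w hw => mem_closedBall_zero_iff.2 (hRφ w (Or.inl hw))
    · rwa [← polydisc_eq_ball]
  refine ⟨R, hR, fun z hz k => ?_⟩
  induction k with
  | zero =>
    intro s hs
    simpa using norm_flow_le hflow hstable hs hz
  | succ k ih =>
    intro s hs
    have : ((k + 1 : ℕ) : ℝ) + s = 1 + (k + s) := by
      push_cast
      ring
    rw [this, hflow.flow_add z (Or.inl hz) (k + s) 1 (by positivity) zero_le_one]
    refine (hstep _ (hflow.flow_mapsTo _ (by positivity) hz)).trans ?_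
    rw [pow_succ', mul_assoc]
    exact mul_le_mul_of_nonneg_left (ih s hs) hR.1.le

/-- The derivative is the weighted defect of the eigenvalue equation along the orbit: zero for exact
eigenfunctions, small for approximate ones. -/
theorem hasDerivWithinAt_comp_flow (hflow : HolomorphicFlow F φ) {ψ : (Fin n → ℂ) → ℂ}
    {z : Fin n → ℂ} (hz : z ∈ polydisc n ∪ torus n) {t : ℝ} (ht : 0 ≤ t)
    (hψ : DifferentiableAt ℂ ψ (φ t z)) (c : ℂ) :
    HasDerivWithinAt (fun s : ℝ => Complex.exp (-c * s) * ψ (φ s z))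
      (Complex.exp (-c * t) * (fderiv ℂ ψ (φ t z) (F (φ t z)) - c * ψ (φ t z))) (Ici 0) t := by
  have h1 : HasDerivWithinAt (fun s : ℝ => ψ (φ s z)) (fderiv ℂ ψ (φ t z) (F (φ t z))) (Ici 0) t :=
    (hψ.hasFDerivAt.restrictScalars ℝ).comp_hasDerivWithinAt (f := fun s => φ s z) t
      (hflow.flow_ode z hz t ht)
  have h2 : HasDerivAt (fun s : ℝ => Complex.exp (-c * s)) (Complex.exp (-c * t) * (-c)) t := by
    have h3 : HasDerivAt (fun s : ℝ => -c * (s : ℂ)) (-c) t := by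
      simpa using (Complex.ofRealCLM.hasDerivAt (x := t)).const_mul (-c)
    exact h3.cexp
  refine (h2.hasDerivWithinAt.mul h1).congr_deriv ?_
  ring

/-- A function that is multiplied by `e^{cs}` along the flow for small times satisfies the
infinitesimal eigenvalue equation. -/
theorem fderiv_eq_of_flow_eq (hflow : HolomorphicFlow F φ) {ψ : (Fin n → ℂ) → ℂ}
    {z : Fin n → ℂ} (hz : z ∈ polydisc n) (hψ : DifferentiableAt ℂ ψ z) {c : ℂ}
    (h : ∀ s ∈ Icc (0 : ℝ) 1, ψ (φ s z) = Complex.exp (c * s) * ψ z) :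
    fderiv ℂ ψ z (F z) = c * ψ z := by
  have h0 := hflow.flow_zero z (Or.inl hz)
  have h1 := hasDerivWithinAt_comp_flow hflow (Or.inl hz) le_rfl (h0 ▸ hψ) c
  simp only [h0, Complex.ofReal_zero, mul_zero, Complex.exp_zero, one_mul] at h1
  have h2 : HasDerivWithinAt (fun s : ℝ => Complex.exp (-c * s) * ψ (φ s z)) 0 (Icc 0 1) 0 := by
    refine (hasDerivWithinAt_const (0 : ℝ) (Icc 0 1) (ψ z)).congr_of_mem (fun s hs => ?_)
      (left_mem_Icc.2 zero_le_one)
    rw [h s hs, ← mul_assoc, ← Complex.exp_add]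
    simp
  have h3 := UniqueDiffWithinAt.eq_deriv _
    (uniqueDiffOn_Icc zero_lt_one 0 (left_mem_Icc.2 zero_le_one)) (h1.mono Icc_subset_Ici_self) h2
  exact sub_eq_zero.1 h3

/-! ### Linearization at the origin -/

/-- An eigenfunction near the origin of the Koopman generator, obtained as the limit of
`e^{-ct} p ∘ φᵗ` for an approximate eigenfunction `p`. -/
theorem exists_eigenfunction_of_approximate (hflow : HolomorphicFlow F φ)
    {R : ℝ} (hR : R ∈ Ioo (0 : ℝ) 1)
    (hφ : ∀ z ∈ polydisc n, ∀ (k : ℕ) (s : ℝ), 0 ≤ s → ‖φ (k + s) z‖ ≤ R ^ k * ‖z‖)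
    {p : (Fin n → ℂ) → ℂ} (hp : Differentiable ℂ p) {c : ℂ} (hc : c.re < 0) {N : ℕ} (hN2 : 2 ≤ N)
    (hN : Real.exp (-c.re) * R ^ N ≤ 1 / 2)
    (hpN : (fun z => fderiv ℂ p z (F z) - c * p z) =O[𝓝 0] fun z => ‖z‖ ^ N) :
    ∃ ψ : (Fin n → ℂ) → ℂ, (fun z => ψ z - p z) =O[𝓝 0] (fun z => ‖z‖ ^ 2) ∧
      ∀ᶠ z in 𝓝 0, DifferentiableAt ℂ ψ z ∧ fderiv ℂ ψ z (F z) = c * ψ z := by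
  obtain ⟨C, hC0, hC⟩ := hpN.exists_nonneg
  obtain ⟨r, hr, hrC⟩ := Metric.eventually_nhds_iff_ball.1
    (hC.bound.and ((isOpen_polydisc n).mem_nhds (zero_mem_polydisc n)))
  set u : (Fin n → ℂ) → ℝ → ℂ := fun z t => Complex.exp (-c * t) * p (φ t z) with hu
  set C' : ℝ := Real.exp (-c.re) * C
  have hC'0 : 0 ≤ C' := by positivity
  have hrpoly : ∀ z ∈ ball (0 : Fin n → ℂ) r, z ∈ polydisc n := fun z hz => (hrC z hz).2
  have hφ' : ∀ z ∈ polydisc n, ∀ s : ℝ, 0 ≤ s → ‖φ s z‖ ≤ ‖z‖ := fun z hz s hs => by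
    simpa using hφ z hz 0 s hs
  have hφr : ∀ z ∈ ball (0 : Fin n → ℂ) r, ∀ s : ℝ, 0 ≤ s → φ s z ∈ ball 0 r := by
    intro z hz s hs
    have := hφ' z (hrpoly z hz) s hs
    rw [mem_ball_zero_iff] at *
    exact this.trans_lt hz
  -- On `[k, k + 1]` the exponential is at most `exp (-c.re) ^ (k + 1)` and the defect at most `C *
  -- (R ^ k * ‖z‖) ^ N`, so `hN` yields the ratio `1 / 2`; the spare factor `exp (-c.re)` sits in
  -- `C'`. Fractional `s` are included in order to compare real times with integer ones.
  have hstep : ∀ z ∈ ball (0 : Fin n → ℂ) r, ∀ k : ℕ, ∀ s ∈ Icc (0 : ℝ) 1,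
      ‖u z (k + s) - u z k‖ ≤ C' * ‖z‖ ^ N * (1 / 2) ^ k := by
    intro z hz k s hs
    have hder : ∀ t ∈ Icc (k : ℝ) (k + 1), HasDerivWithinAt (u z)
        (Complex.exp (-c * t) * (fderiv ℂ p (φ t z) (F (φ t z)) - c * p (φ t z)))
        (Icc (k : ℝ) (k + 1)) t := fun t ht =>
      (hasDerivWithinAt_comp_flow hflow (Or.inl (hrpoly z hz)) (k.cast_nonneg.trans ht.1)
        (hp _) c).mono fun x hx => k.cast_nonneg.trans hx.1
    have hbound : ∀ t ∈ Ico (k : ℝ) (k + 1),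
        ‖Complex.exp (-c * t) * (fderiv ℂ p (φ t z) (F (φ t z)) - c * p (φ t z))‖ ≤
          C' * ‖z‖ ^ N * (1 / 2) ^ k := by
      intro t ht
      have ht0 : 0 ≤ t := k.cast_nonneg.trans ht.1
      have h1 : ‖φ t z‖ ≤ R ^ k * ‖z‖ := by
        simpa using hφ z (hrpoly z hz) k (t - k) (sub_nonneg.2 ht.1)
      have h2 := (hrC _ (hφr z hz t ht0)).1
      rw [norm_pow, norm_norm] at h2
      have h3 : ‖Complex.exp (-c * t)‖ ≤ Real.exp (-c.re) * Real.exp (-c.re) ^ k := by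
        rw [Complex.norm_exp, ← Real.exp_nat_mul, ← Real.exp_add]
        apply Real.exp_le_exp.2
        simp only [Complex.mul_re, Complex.neg_re, Complex.ofReal_re, Complex.ofReal_im, mul_zero,
          sub_zero]
        nlinarith [ht.2]
      calc _ ≤ Real.exp (-c.re) * Real.exp (-c.re) ^ k * (C * (R ^ k * ‖z‖) ^ N) := by
            rw [norm_mul]
            refine mul_le_mul h3 (h2.trans ?_) (norm_nonneg _) (by positivity)
            gcongr
        _ = C' * ‖z‖ ^ N * (Real.exp (-c.re) * R ^ N) ^ k := by
            rw [mul_pow, mul_pow, ← pow_mul, ← pow_mul, mul_comm k N]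
            ring
        _ ≤ _ := by
            have : 0 ≤ Real.exp (-c.re) * R ^ N := by
              have := hR.1
              positivity
            gcongr
    have := norm_image_sub_le_of_norm_deriv_le_segment' hder hbound (k + s)
      ⟨by linarith [hs.1], by linarith [hs.2]⟩
    refine this.trans ?_
    rw [add_sub_cancel_left]
    exact mul_le_of_le_one_right (by positivity) hs.2
  have hdist : ∀ z ∈ ball (0 : Fin n → ℂ) r, ∀ k : ℕ,
      dist (u z (k : ℕ)) (u z ((k + 1 : ℕ) : ℝ)) ≤ C' * ‖z‖ ^ N * (1 / 2) ^ k := by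
    intro z hz k
    rw [dist_comm, dist_eq_norm]
    have := hstep z hz k 1 ⟨zero_le_one, le_rfl⟩
    simpa using this
  have hlim : ∀ z ∈ ball (0 : Fin n → ℂ) r, ∃ L, Tendsto (fun k : ℕ => u z k) atTop (𝓝 L) :=
    fun z hz => cauchySeq_tendsto_of_complete
      (cauchySeq_of_le_geometric (1 / 2) _ (by norm_num) (hdist z hz))
  choose! ψ hψ using hlim
  have hrate : ∀ z ∈ ball (0 : Fin n → ℂ) r, ∀ k : ℕ,
      dist (u z k) (ψ z) ≤ C' * ‖z‖ ^ N * (1 / 2) ^ k / (1 - 1 / 2) := fun z hz =>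
    dist_le_of_le_geometric_of_tendsto (1 / 2) _ (by norm_num) (hdist z hz) (hψ z hz)
  have hhalf : Tendsto (fun k : ℕ => (1 / 2 : ℝ) ^ k) atTop (𝓝 0) :=
    tendsto_pow_atTop_nhds_zero_of_lt_one (by norm_num) (by norm_num)
  refine ⟨ψ, ?_, ?_⟩
  · refine IsBigO.trans (IsBigO.of_bound (2 * C') ?_) (norm_pow_isBigO_of_le hN2)
    filter_upwards [ball_mem_nhds (0 : Fin n → ℂ) hr] with z hz
    have := hrate z hz 0
    simp only [hu, Nat.cast_zero, Complex.ofReal_zero, mul_zero, Complex.exp_zero, one_mul,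
      hflow.flow_zero z (Or.inl (hrpoly z hz)), pow_zero] at this
    rw [dist_comm, dist_eq_norm] at this
    refine this.trans (le_of_eq ?_)
    rw [norm_pow, norm_norm]
    ring
  · have hdiff : DifferentiableOn ℂ ψ (ball 0 r) := by
      refine differentiableOn_of_tendstoUniformlyOn (f := fun (k : ℕ) z => u z k) isOpen_ball
        (fun k => ?_) ?_
      · refine (hp.comp_differentiableOn ?_).const_mul _
        exact (hflow.flow_holomorphic k k.cast_nonneg).mono hrpoly
      · rw [Metric.tendstoUniformlyOn_iff]
        intro ε hε
        have h1 : Tendsto (fun k : ℕ => 2 * C' * r ^ N * (1 / 2) ^ k) atTop (𝓝 0) := by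
          simpa using hhalf.const_mul (2 * C' * r ^ N)
        filter_upwards [h1.eventually (gt_mem_nhds hε)] with k hk z hz
        rw [dist_comm]
        refine ((hrate z hz k).trans ?_).trans_lt hk
        rw [mem_ball_zero_iff] at hz
        calc C' * ‖z‖ ^ N * (1 / 2) ^ k / (1 - 1 / 2) = 2 * C' * ‖z‖ ^ N * (1 / 2) ^ k := by ring
          _ ≤ _ := by gcongr
    filter_upwards [ball_mem_nhds (0 : Fin n → ℂ) hr] with z hz
    have hd := hdiff.differentiableAt (isOpen_ball.mem_nhds hz)
    refine ⟨hd, fderiv_eq_of_flow_eq hflow (hrpoly z hz) hd fun s hs => ?_⟩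
    have h1 := hψ _ (hφr z hz s hs.1)
    -- The limit `ψ` is defined along integer times. Shifting these by `s` does not change it, and
    -- this shift is the action of `φ s`.
    have h2 : Tendsto (fun k : ℕ => Complex.exp (c * s) * u z (k + s)) atTop
        (𝓝 (Complex.exp (c * s) * ψ z)) := by
      refine Tendsto.const_mul _ ?_
      have h3 : Tendsto (fun k : ℕ => u z (k + s) - u z k) atTop (𝓝 0) :=
        squeeze_zero_norm (fun k => hstep z hz k s hs)
          (by simpa using hhalf.const_mul (C' * ‖z‖ ^ N))
      simpa using h3.add (hψ z hz)
    refine tendsto_nhds_unique h1 (h2.congr fun k => ?_)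
    simp only [hu]
    rw [hflow.flow_add z (Or.inl (hrpoly z hz)) s k hs.1 k.cast_nonneg, ← mul_assoc,
      ← Complex.exp_add]
    congr 2
    push_cast
    ring

/-- A basis of eigenvectors of the linear part, with its dual basis. -/
theorem exists_eigenbasis (hstable : StableHyperbolicEquilibrium F φ lam) :
    ∃ (b : Fin n → Fin n → ℂ) (ℓ : Fin n → (Fin n → ℂ) →L[ℂ] ℂ),
      (∀ z, ∑ l, ℓ l z • b l = z) ∧ (∀ l, fderiv ℂ F 0 (b l) = lam l • b l) ∧
      ∀ l z, ℓ l (fderiv ℂ F 0 z) = lam l * ℓ l z := by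
  have hev : ∀ l, ∃ v, Module.End.HasEigenvector (Matrix.toLin' (jacobianZero F)) (lam l) v := by
    intro l
    apply Module.End.HasEigenvalue.exists_hasEigenvector
    rw [Module.End.hasEigenvalue_iff_isRoot_charpoly, Matrix.charpoly_toLin',
      hstable.eigenvalues, Polynomial.IsRoot, Polynomial.eval_prod]
    exact Finset.prod_eq_zero (Finset.mem_univ l) (by simp)
  choose v hv using hev
  have hli := Module.End.eigenvectors_linearIndependent' _ _ hstable.simple v hv
  set B := Module.Basis.mk hli (hli.span_eq_top_of_card_eq_finrank' (by simp)).ge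
  have hB : ∀ l, fderiv ℂ F 0 (B l) = lam l • B l := by
    intro l
    have := (hv l).apply_eq_smul
    rw [Matrix.toLin'_apply, jacobianZero_mulVec] at this
    simpa [B] using this
  refine ⟨B, fun l => (B.coord l).toContinuousLinearMap, fun z => ?_, hB, fun l z => ?_⟩
  · simp [B.sum_repr z]
  · have : (B.coord l) ∘ₗ (fderiv ℂ F 0).toLinearMap = lam l • B.coord l := by
      refine B.ext fun k => ?_
      simp only [LinearMap.comp_apply, ContinuousLinearMap.coe_coe, hB, map_smul, smul_eq_mul,
        LinearMap.smul_apply, Module.Basis.coord_apply, Module.Basis.repr_self]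
      rcases eq_or_ne k l with rfl | hkl
      · rfl
      · simp [Finsupp.single_eq_of_ne, hkl.symm]
    simpa using LinearMap.congr_fun this z

/-- Poincaré's linearization theorem for the vector fields considered here. -/
theorem exists_linearizingConjugacy (hflow : HolomorphicFlow F φ) (hinv : ForwardInvariant φ)
    (hstable : StableHyperbolicEquilibrium F φ lam) (hres : Nonresonant lam) :
    ∃ Ω ν, LinearizingConjugacy F Ω ν := by
  obtain ⟨b, ℓ, hb, hAb, hAℓ⟩ := exists_eigenbasis hstable
  obtain ⟨R, hR, hφR⟩ := exists_norm_flow_add_le hflow hinv hstable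
  have hFd : ∀ᶠ z in 𝓝 0, DifferentiableAt ℂ F z := by
    filter_upwards [(isOpen_polydisc n).mem_nhds (zero_mem_polydisc n)] with z hz
    exact hflow.field_holomorphic.differentiableAt ((isOpen_polydisc n).mem_nhds hz)
  have hex : ∀ j, ∃ ψ : (Fin n → ℂ) → ℂ, (fun z => ψ z - ℓ j z) =O[𝓝 0] (fun z => ‖z‖ ^ 2) ∧
      ∀ᶠ z in 𝓝 0, DifferentiableAt ℂ ψ z ∧ fderiv ℂ ψ z (F z) = lam j * ψ z := by
    intro j
    -- The order of the approximation is chosen so that the contraction beats the growth of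
    -- `e^{-λt}` over unit time.
    have h1 : Tendsto (fun N : ℕ => Real.exp (-(lam j).re) * R ^ (N + 2)) atTop (𝓝 0) := by
      have := ((tendsto_pow_atTop_nhds_zero_of_lt_one hR.1.le hR.2).comp
        (tendsto_add_atTop_nat 2)).const_mul (Real.exp (-(lam j).re))
      simpa using this
    obtain ⟨N, hN⟩ := (h1.eventually (gt_mem_nhds (show (0 : ℝ) < 1 / 2 by norm_num))).exists
    obtain ⟨p, hp, hp2, hpN⟩ := exists_approximate_eigenfunction hb hFd hstable.equilibrium hAℓ j
      (fun m hm => hres m hm j) N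
    obtain ⟨ψ, hψ2, hψ⟩ := exists_eigenfunction_of_approximate hflow hR hφR hp
      (hstable.re_neg j) (by omega) hN.le hpN
    exact ⟨ψ, (hψ2.add hp2).congr_left fun z => by ring, hψ⟩
  choose ψ hψ2 hψ using hex
  -- Since `ψ l` agrees with the coordinate `ℓ l` to first order, recombining with the eigenbasis
  -- gives a map tangent to the identity.
  set ν : (Fin n → ℂ) → (Fin n → ℂ) := fun z => ∑ l, ψ l z • b l with hν
  have hsub : (fun z => ν z - z) =O[𝓝 0] fun z => ‖z‖ ^ 2 := by
    have h1 : (fun z => ∑ l, (ψ l z - ℓ l z) • b l) =O[𝓝 0] fun z => ‖z‖ ^ 2 :=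
      IsBigO.fun_sum fun l _ => IsBigO.trans
        (IsBigO.of_bound ‖b l‖ (Eventually.of_forall fun z => by
          rw [norm_smul, mul_comm])) (hψ2 l)
    refine h1.congr_left fun z => ?_
    simp only [sub_smul, Finset.sum_sub_distrib, hb, hν]
  have hν0 : ν 0 = 0 := by
    obtain ⟨B, hB⟩ := hsub.bound
    simpa using hB.self_of_nhds
  have hfd : HasFDerivAt ν (ContinuousLinearEquiv.refl ℂ (Fin n → ℂ) :
      (Fin n → ℂ) →L[ℂ] (Fin n → ℂ)) 0 := by
    rw [hasFDerivAt_iff_isLittleO_nhds_zero]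
    have h1 : (fun z : Fin n → ℂ => ‖z‖ ^ 2) =o[𝓝 0] fun z => z := by
      rw [← isLittleO_norm_right]
      simpa using isLittleO_norm_pow_norm_pow (E' := Fin n → ℂ) (show 1 < 2 by omega)
    simpa [hν0] using hsub.trans_isLittleO h1
  obtain ⟨r, hr, hrψ⟩ := Metric.eventually_nhds_iff_ball.1
    ((eventually_all.2 hψ).and ((isOpen_polydisc n).mem_nhds (zero_mem_polydisc n)))
  have hνd : DifferentiableOn ℂ ν (ball 0 r) := fun z hz =>
    (DifferentiableAt.fun_sum fun l _ =>
      (((hrψ z hz).1 l).1.smul_const (b l))).differentiableWithinAt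
  have hcd : ContDiffAt ℂ 1 ν 0 :=
    (hνd.contDiffOn_one_complex isOpen_ball).contDiffAt (ball_mem_nhds 0 hr)
  set e := hcd.toOpenPartialHomeomorph ν hfd one_ne_zero
  have hee : (e : (Fin n → ℂ) → (Fin n → ℂ)) = ν := rfl
  have hinvd : ContDiffAt ℂ 1 e.symm (ν 0) := hcd.to_localInverse hfd one_ne_zero
  have hsymm : ∀ᶠ y in 𝓝 (ν 0), DifferentiableAt ℂ e.symm y :=
    (hinvd.eventually (by simp)).mono fun y hy => hy.differentiableAt one_ne_zero
  have hsource : e.source ∈ 𝓝 (0 : Fin n → ℂ) :=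
    e.open_source.mem_nhds (hcd.mem_toOpenPartialHomeomorph_source hfd one_ne_zero)
  obtain ⟨ρ, hρ, hρb⟩ := Metric.eventually_nhds_iff_ball.1
    ((Filter.Eventually.and (ball_mem_nhds (0 : Fin n → ℂ) hr) hsource).and
      (hcd.continuousAt.eventually hsymm))
  refine ⟨ball 0 ρ, ν, isOpen_ball, mem_ball_self hρ, ?_, fun z hz => ?_, ?_, ?_,
    ⟨e.symm, ?_, fun z hz => ?_⟩, hν0, fun z hz => ?_⟩
  · exact (convex_ball _ _).isPreconnected
  · exact (hrψ z (hρb z hz).1.1).2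
  · exact hνd.mono fun z hz => (hρb z hz).1.1
  · rw [← hee]
    exact e.isOpen_image_of_subset_source isOpen_ball fun z hz => (hρb z hz).1.2
  · rintro _ ⟨z, hz, rfl⟩
    exact (hρb z hz).2.differentiableWithinAt
  · exact e.left_inv (hρb z hz).1.2
  · have hz' := (hrψ z (hρb z hz).1.1).1
    rw [jacobianZero_mulVec]
    have h1 : HasFDerivAt ν (∑ l, (fderiv ℂ (ψ l) z).smulRight (b l)) z :=
      HasFDerivAt.fun_sum fun l _ => (hz' l).1.hasFDerivAt.smul_const (b l)
    rw [h1.fderiv]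
    simp only [hν, map_sum, map_smul, hAb, _root_.sum_apply,
      ContinuousLinearMap.smulRight_apply, (hz' _).2, smul_smul]
    exact Finset.sum_congr rfl fun l _ => by rw [mul_comm]

end KoopmanHardy

/-! ### Membership in the Hardy space -/

namespace KoopmanHardy

variable {n : ℕ} {F : (Fin n → ℂ) → (Fin n → ℂ)} {φ : ℝ → (Fin n → ℂ) → (Fin n → ℂ)}
  {lam : Fin n → ℂ} {Ω : Set (Fin n → ℂ)} {ν : (Fin n → ℂ) → (Fin n → ℂ)} {w : Fin n → ℂ} {c : ℂ}

/-- A bounded holomorphic function on the polydisc with a continuous extension to the torus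
belongs to the Hardy space. -/
theorem mem_hardySpace_of_continuousOn {f g : (Fin n → ℂ) → ℂ}
    (hf : DifferentiableOn ℂ f (polydisc n)) (hfg : EqOn f g (polydisc n))
    (hg : ContinuousOn g (polydisc n ∪ torus n)) {M : ℝ} (hM : ∀ z ∈ polydisc n, ‖f z‖ ≤ M) :
    f ∈ hardySpace n := by
  set e : (Fin n → ℝ) → Fin n → ℂ := fun θ k => Complex.exp ((θ k : ℂ) * Complex.I) with he
  have hec : Continuous e := by fun_prop
  have het : ∀ θ, e θ ∈ torus n := fun θ k => Complex.norm_exp_ofReal_mul_I (θ k)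
  have hIoo : ∀ᶠ r : ℝ in 𝓝[<] 1, r ∈ Ioo (0 : ℝ) 1 := Ioo_mem_nhdsLT zero_lt_one
  -- Dominated convergence with the constant `M ^ 2`. The limit involves `g`, because the values of
  -- `f` on the torus are arbitrary.
  refine ⟨hf, _, Tendsto.const_mul _ (tendsto_integral_filter_of_dominated_convergence
    (f := fun θ => ‖g (e θ)‖ ^ 2) (fun _ => M ^ 2) ?_ ?_ ?_ ?_)⟩
  · filter_upwards [hIoo] with r hr
    refine Continuous.aestronglyMeasurable (Continuous.pow (Continuous.norm ?_) 2)
    exact hf.continuousOn.comp_continuous (f := fun θ => (r : ℂ) • e θ) (by fun_prop)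
      fun θ => smul_mem_polydisc (het θ) hr.1.le hr.2
  · filter_upwards [hIoo] with r hr
    refine Eventually.of_forall fun θ => ?_
    rw [Real.norm_of_nonneg (by positivity)]
    gcongr
    exact hM _ (smul_mem_polydisc (het θ) hr.1.le hr.2)
  · refine integrableOn_const (ne_of_lt ?_)
    rw [Real.volume_pi_Ioc]
    exact ENNReal.prod_lt_top fun _ _ => ENNReal.ofReal_lt_top
  · refine Eventually.of_forall fun θ => ?_
    have h1 : Tendsto (fun r : ℝ => (r : ℂ) • e θ) (𝓝[<] 1) (𝓝[polydisc n ∪ torus n] (e θ)) := by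
      refine tendsto_nhdsWithin_iff.2 ⟨?_, ?_⟩
      · have h2 : Continuous fun r : ℝ => (r : ℂ) • e θ := by fun_prop
        have := (h2.tendsto 1).mono_left (nhdsWithin_le_nhds (s := Iio 1))
        simpa using this
      · filter_upwards [hIoo] with r hr
        exact Or.inl (smul_mem_polydisc (het θ) hr.1.le hr.2)
    refine (((hg _ (Or.inr (het θ))).tendsto.comp h1).norm.pow 2).congr' ?_
    filter_upwards [hIoo] with r hr
    have := hfg (smul_mem_polydisc (het θ) hr.1.le hr.2)
    simp only [Function.comp_apply, ← this]
    rfl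

/-- The time-one map sends `𝔻ⁿ ∪ 𝕋ⁿ` into a compact part of `𝔻ⁿ`, where `f` is bounded and
continuous. So `e^{-c} f ∘ φ 1` provides boundary values, although nothing is assumed about `f` near
the torus. -/
theorem mem_hardySpace_of_flow_eq (hflow : HolomorphicFlow F φ) (hinv : ForwardInvariant φ)
    {f : (Fin n → ℂ) → ℂ} (hf : DifferentiableOn ℂ f (polydisc n))
    (h : ∀ z ∈ polydisc n, f z = Complex.exp (-c) * f (φ 1 z)) : f ∈ hardySpace n := by
  obtain ⟨R, hR, hφ⟩ := exists_norm_flow_le hflow hinv one_pos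
  have hsub : closedBall 0 R ⊆ polydisc n := by
    rw [polydisc_eq_ball]
    exact closedBall_subset_ball hR.2
  obtain ⟨M, hM⟩ := (isCompact_closedBall (0 : Fin n → ℂ) R).exists_bound_of_continuousOn
    (hf.continuousOn.mono hsub)
  refine mem_hardySpace_of_continuousOn hf (g := fun z => Complex.exp (-c) * f (φ 1 z)) h ?_
    (M := ‖Complex.exp (-c)‖ * M) fun z hz => ?_
  · refine ContinuousOn.mul continuousOn_const
      (hf.continuousOn.comp (hflow.flow_continuous 1 zero_le_one) fun z hz => ?_)
    exact flow_mem_polydisc hflow hinv one_pos hz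
  · rw [h z hz, norm_mul]
    gcongr
    exact hM _ (mem_closedBall_zero_iff.2 (hφ z (Or.inl hz)))

/-- Solutions of the infinitesimal eigenvalue equation along an orbit are multiplied by an
exponential along this orbit. -/
theorem exp_mul_comp_flow_eq (hflow : HolomorphicFlow F φ) {ψ : (Fin n → ℂ) → ℂ} {z : Fin n → ℂ}
    (hz : z ∈ polydisc n ∪ torus n) {t : ℝ} (ht : 0 ≤ t)
    (h : ∀ s ∈ Icc 0 t, DifferentiableAt ℂ ψ (φ s z) ∧
      fderiv ℂ ψ (φ s z) (F (φ s z)) = c * ψ (φ s z)) :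
    ψ z = Complex.exp (-c * t) * ψ (φ t z) := by
  have hder : ∀ s ∈ Icc 0 t, HasDerivWithinAt (fun s : ℝ => Complex.exp (-c * s) * ψ (φ s z)) 0
      (Ici 0) s := fun s hs => by
    simpa [(h s hs).2] using hasDerivWithinAt_comp_flow hflow hz hs.1 (h s hs).1 c
  have := constant_of_has_deriv_right_zero
    (fun s hs => ((hder s hs).continuousWithinAt).mono fun x hx => hx.1)
    (fun s hs => (hder s ⟨hs.1, hs.2.le⟩).mono fun x hx => hs.1.trans hx) t ⟨ht, le_rfl⟩
  simp only [Complex.ofReal_zero, mul_zero, Complex.exp_zero, one_mul, hflow.flow_zero z hz] at this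
  exact this.symm

theorem mem_hardySpace_of_koopmanGenerator_eq (hflow : HolomorphicFlow F φ)
    (hinv : ForwardInvariant φ) {f : (Fin n → ℂ) → ℂ} (hf : DifferentiableOn ℂ f (polydisc n))
    (h : ∀ z ∈ polydisc n, koopmanGenerator F f z = c * f z) : f ∈ hardySpace n := by
  refine mem_hardySpace_of_flow_eq (c := c) hflow hinv hf fun z hz => ?_
  have := exp_mul_comp_flow_eq (c := c) hflow (ψ := f) (Or.inl hz) zero_le_one fun s hs => by
    have hs' := hflow.flow_mapsTo s hs.1 hz
    refine ⟨hf.differentiableAt ((isOpen_polydisc n).mem_nhds hs'), ?_⟩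
    rw [← koopmanGenerator_apply, h _ hs']
  simpa using this

/-! ### Principal eigenfunctions -/

/-- A principal eigenfunction is holomorphic on the polydisc and an eigenfunction of the flow. -/
theorem IsPrincipalEigenfunction.differentiableOn_and_flow_eq (hflow : HolomorphicFlow F φ)
    (hinv : ForwardInvariant φ) (hstable : StableHyperbolicEquilibrium F φ lam)
    (hΩ : Ω ∈ 𝓝 0) (hΩo : IsOpen Ω) (hν : DifferentiableOn ℂ ν Ω) {f : (Fin n → ℂ) → ℂ}
    (hf : IsPrincipalEigenfunction φ Ω ν w c f) :
    DifferentiableOn ℂ f (polydisc n) ∧ ∀ z ∈ polydisc n ∪ torus n, ∀ t : ℝ, 0 ≤ t →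
      f z = Complex.exp (-c * t) * f (φ t z) := by
  constructor
  · intro z hz
    obtain ⟨t, ht0, ht⟩ := ((eventually_ge_atTop (0 : ℝ)).and
      ((hstable.attracts z (Or.inl hz)).eventually hΩ)).exists
    have hφd := (hflow.flow_holomorphic t ht0).differentiableAt ((isOpen_polydisc n).mem_nhds hz)
    -- One time `t` serves a whole neighborhood of `z`, since `Ω` is open.
    have hev : f =ᶠ[𝓝 z] fun y => Complex.exp (-c * t) * (star w ⬝ᵥ ν (φ t y)) := by
      filter_upwards [(isOpen_polydisc n).mem_nhds hz,
        hφd.continuousAt.eventually (hΩo.mem_nhds ht)] with y hy hyΩ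
      rw [hf.2 y (Or.inl hy) t ht0 hyΩ, hf.1 _ hyΩ]
    have hνd : DifferentiableAt ℂ (fun y => ν (φ t y)) z :=
      (hν.differentiableAt (hΩo.mem_nhds ht)).comp z hφd
    refine (DifferentiableAt.congr_of_eventuallyEq ?_ hev).differentiableWithinAt
    refine DifferentiableAt.const_mul ?_ _
    exact DifferentiableAt.fun_sum fun k _ => (differentiableAt_pi.1 hνd k).const_mul _
  · intro z hz t ht
    -- A later time `s ≥ t` with `φ s z ∈ Ω` lets the defining relation be used both from `z` and
    -- from `φ t z`; `φ t z` itself need not lie in `Ω`.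
    obtain ⟨s, hst, hs⟩ := ((eventually_ge_atTop t).and
      ((hstable.attracts z hz).eventually hΩ)).exists
    have h1 : φ (s - t) (φ t z) = φ s z := by
      rw [← hflow.flow_add z hz t (s - t) ht (sub_nonneg.2 hst), sub_add_cancel]
    have h2 := hf.2 (φ t z) (flow_mem hflow hinv ht hz) (s - t) (sub_nonneg.2 hst) (h1 ▸ hs)
    rw [h2, h1, hf.2 z hz s (ht.trans hst) hs, ← mul_assoc, ← Complex.exp_add]
    congr 2
    push_cast
    ring

theorem LinearizingConjugacy.fderiv_dotProduct (hν : LinearizingConjugacy F Ω ν)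
    {z : Fin n → ℂ} (hz : z ∈ Ω) (hw : IsLeftEigenvector (jacobianZero F) c w) :
    DifferentiableAt ℂ (fun z => star w ⬝ᵥ ν z) z ∧
      fderiv ℂ (fun z => star w ⬝ᵥ ν z) z (F z) = c * (star w ⬝ᵥ ν z) := by
  have hd := hν.holomorphic.differentiableAt (hν.isOpen.mem_nhds hz)
  have h1 : HasFDerivAt (fun z => star w ⬝ᵥ ν z)
      (∑ k, star w k • (ContinuousLinearMap.proj (R := ℂ) (φ := fun _ => ℂ) k ∘L fderiv ℂ ν z)) z :=
    HasFDerivAt.fun_sum fun k _ =>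
      ((hasFDerivAt_pi'.1 hd.hasFDerivAt) k).const_mul (star w k)
  refine ⟨h1.differentiableAt, ?_⟩
  rw [h1.fderiv]
  have h2 : star w ⬝ᵥ fderiv ℂ ν z (F z) = c * (star w ⬝ᵥ ν z) := by
    rw [hν.conjugates z hz, Matrix.dotProduct_mulVec, hw.2, smul_dotProduct, smul_eq_mul]
  rw [← h2]
  simp [dotProduct]

/-- Existence of the principal eigenfunction extending `w* · ν` from a small ball. -/
theorem exists_isPrincipalEigenfunction_ball (hflow : HolomorphicFlow F φ)
    (hstable : StableHyperbolicEquilibrium F φ lam) (hν : LinearizingConjugacy F Ω ν)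
    (hw : IsLeftEigenvector (jacobianZero F) c w) {ρ : ℝ} (hρ : 0 < ρ) (hρΩ : ball 0 ρ ⊆ Ω) :
    ∃ f, IsPrincipalEigenfunction φ (ball 0 ρ) ν w c f := by
  have hpoly : ball 0 ρ ⊆ polydisc n := hρΩ.trans hν.subset
  set g : (Fin n → ℂ) → ℂ := fun z => star w ⬝ᵥ ν z
  -- By the Schwarz lemma an orbit starting in the ball stays there, so the eigenvalue equation for
  -- `w* · ν` can be integrated along it.
  have hg : ∀ z ∈ ball 0 ρ, ∀ t : ℝ, 0 ≤ t → g z = Complex.exp (-c * t) * g (φ t z) := by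
    intro z hz t ht
    refine exp_mul_comp_flow_eq hflow (Or.inl (hpoly hz)) ht fun s hs =>
      hν.fderiv_dotProduct (hρΩ ?_) hw
    have := norm_flow_le hflow hstable hs.1 (hpoly hz)
    rw [mem_ball_zero_iff] at *
    exact this.trans_lt hz
  have hT : ∀ z ∈ polydisc n ∪ torus n, ∃ t : ℝ, 0 ≤ t ∧ φ t z ∈ ball 0 ρ := fun z hz =>
    ((eventually_ge_atTop (0 : ℝ)).and
      ((hstable.attracts z hz).eventually (ball_mem_nhds 0 hρ))).exists
  have hmono : ∀ z ∈ polydisc n ∪ torus n, ∀ s t : ℝ, 0 ≤ s → s ≤ t → φ s z ∈ ball 0 ρ →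
      Complex.exp (-c * s) * g (φ s z) = Complex.exp (-c * t) * g (φ t z) := by
    intro z hz s t hs hst hsz
    have h1 : φ (t - s) (φ s z) = φ t z := by
      rw [← hflow.flow_add z hz s (t - s) hs (sub_nonneg.2 hst), sub_add_cancel]
    rw [hg _ hsz (t - s) (sub_nonneg.2 hst), h1, ← mul_assoc, ← Complex.exp_add]
    congr 2
    push_cast
    ring
  have hindep : ∀ z ∈ polydisc n ∪ torus n, ∀ s t : ℝ, 0 ≤ s → 0 ≤ t → φ s z ∈ ball 0 ρ →
      φ t z ∈ ball 0 ρ → Complex.exp (-c * s) * g (φ s z) = Complex.exp (-c * t) * g (φ t z) := by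
    intro z hz s t hs ht hsz htz
    rcases le_total s t with hst | hst
    · exact hmono z hz s t hs hst hsz
    · exact (hmono z hz t s ht hst htz).symm
  -- Any hitting time of the ball may serve as `T z`, since `hindep` makes the value independent of
  -- it.
  choose! T hT0 hT using hT
  set f : (Fin n → ℂ) → ℂ := fun z => Complex.exp (-c * T z) * g (φ (T z) z)
  have hfg : ∀ z ∈ ball 0 ρ, f z = g z := fun z hz => by
    have hz' := Or.inl (b := z ∈ torus n) (hpoly hz)
    have h0 := hflow.flow_zero z hz'
    have := hindep z hz' (T z) 0 (hT0 z hz') le_rfl (hT z hz') (by rwa [h0])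
    simpa [h0, f] using this
  refine ⟨f, hfg, fun z hz t ht htz => ?_⟩
  rw [hfg _ htz]
  exact hindep z hz (T z) t (hT0 z hz) ht (hT z hz) htz

/-- Orbits may leave `Ω` and return, so the extension is built from a ball inside `Ω`. Connectedness
of `Ω` and the identity theorem then give `w* · ν` on all of `Ω`. -/
theorem exists_isPrincipalEigenfunction (hflow : HolomorphicFlow F φ) (hinv : ForwardInvariant φ)
    (hstable : StableHyperbolicEquilibrium F φ lam) (hν : LinearizingConjugacy F Ω ν)
    (hw : IsLeftEigenvector (jacobianZero F) c w) :
    ∃ f, IsPrincipalEigenfunction φ Ω ν w c f := by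
  obtain ⟨ρ, hρ, hρΩ⟩ := Metric.isOpen_iff.1 hν.isOpen 0 hν.zero_mem
  obtain ⟨f, hf⟩ := exists_isPrincipalEigenfunction_ball hflow hstable hν hw hρ hρΩ
  obtain ⟨hfd, hfφ⟩ := hf.differentiableOn_and_flow_eq hflow hinv hstable (ball_mem_nhds 0 hρ)
    isOpen_ball (hν.holomorphic.mono hρΩ)
  refine ⟨f, ?_, fun z hz t ht _ => hfφ z hz t ht⟩
  refine eqOn_of_preconnected_of_eventuallyEq_complex hν.isOpen hν.connected
    (hfd.mono hν.subset)
    (fun z hz => (hν.fderiv_dotProduct hz hw).1.differentiableWithinAt) hν.zero_mem ?_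
  filter_upwards [ball_mem_nhds 0 hρ] with z hz
  exact hf.1 z hz

open scoped ComplexOrder in
-- The open set `ν(Ω)` contains some `s • w` with `s ≠ 0`, where the functional takes the value `s *
-- (w* · w) ≠ 0`.
theorem IsPrincipalEigenfunction.exists_ne_zero (hν : LinearizingConjugacy F Ω ν)
    (hw : w ≠ 0) {f : (Fin n → ℂ) → ℂ} (hf : IsPrincipalEigenfunction φ Ω ν w c f) :
    ∃ z ∈ polydisc n, f z ≠ 0 := by
  have h0 : ν '' Ω ∈ 𝓝 0 := hν.image_open.mem_nhds ⟨0, hν.zero_mem, hν.map_zero⟩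
  have hlim : Tendsto (fun s : ℂ => s • w) (𝓝[≠] 0) (𝓝 0) := by
    have h1 : Continuous fun s : ℂ => s • w := by fun_prop
    have := (h1.tendsto 0).mono_left (nhdsWithin_le_nhds (s := {0}ᶜ))
    simpa using this
  obtain ⟨s, ⟨z, hz, hzs⟩, hs⟩ := ((hlim.eventually h0).and self_mem_nhdsWithin).exists
  refine ⟨z, hν.subset hz, ?_⟩
  rw [hf.1 z hz, hzs, dotProduct_smul, smul_eq_mul]
  exact mul_ne_zero hs fun h => hw (dotProduct_star_self_eq_zero.1 h)

/-- The transpose has the same characteristic polynomial; its eigenvector is conjugated to match the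
`star` in the definition. -/
theorem exists_isLeftEigenvector (hstable : StableHyperbolicEquilibrium F φ lam) (j : Fin n) :
    ∃ w, IsLeftEigenvector (jacobianZero F) (lam j) w := by
  have h : Module.End.HasEigenvalue (Matrix.toLin' (jacobianZero F)ᵀ) (lam j) := by
    rw [Module.End.hasEigenvalue_iff_isRoot_charpoly, Matrix.charpoly_toLin',
      Matrix.charpoly_transpose, hstable.eigenvalues, Polynomial.IsRoot, Polynomial.eval_prod]
    exact Finset.prod_eq_zero (Finset.mem_univ j) (by simp)
  obtain ⟨v, hv⟩ := h.exists_hasEigenvector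
  refine ⟨star v, star_ne_zero.2 hv.2, ?_⟩
  have := hv.apply_eq_smul
  rwa [Matrix.toLin'_apply, Matrix.mulVec_transpose, ← star_star v] at this

end KoopmanHardy

open KoopmanHardy

theorem proposition3p4 {n m : ℕ}
    (F : (Fin n → ℂ) → (Fin n → ℂ)) (φ : ℝ → (Fin n → ℂ) → (Fin n → ℂ))
    (lam : Fin n → ℂ) (h : (Fin n → ℂ) → (Fin m → ℂ))
    (hflow : KoopmanHardy.HolomorphicFlow F φ)
    (hinv : KoopmanHardy.ForwardInvariant φ)
    (hstable : KoopmanHardy.StableHyperbolicEquilibrium F φ lam)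
    (hres : KoopmanHardy.Nonresonant lam)
    (hout : ∀ i, (fun z => h z i) ∈ KoopmanHardy.hardySpace n) :
    -- a linearizing conjugacy exists
    (∃ Ω ν, KoopmanHardy.LinearizingConjugacy F Ω ν) ∧
    -- each conjugacy yields principal eigenfunctions
    (∀ Ω ν, KoopmanHardy.LinearizingConjugacy F Ω ν → ∀ j : Fin n,
      (∃ w, KoopmanHardy.IsLeftEigenvector (KoopmanHardy.jacobianZero F) (lam j) w) ∧
      ∀ w, KoopmanHardy.IsLeftEigenvector (KoopmanHardy.jacobianZero F) (lam j) w →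
        (∃ f, KoopmanHardy.IsPrincipalEigenfunction φ Ω ν w (lam j) f) ∧
        -- and these are eigenfunctions that lie in the Hardy space
        ∀ f, KoopmanHardy.IsPrincipalEigenfunction φ Ω ν w (lam j) f →
          f ∈ KoopmanHardy.hardySpace n ∧
          (∃ z ∈ KoopmanHardy.polydisc n, f z ≠ 0) ∧
          f ∈ KoopmanHardy.koopmanGeneratorDomain F ∧
          (∀ z ∈ KoopmanHardy.polydisc n,
            KoopmanHardy.koopmanGenerator F f z = lam j * f z) ∧
          (∀ t : ℝ, 0 ≤ t → ∀ z ∈ KoopmanHardy.polydisc n,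
            KoopmanHardy.koopman φ t f z = Complex.exp (lam j * t) * f z)) ∧
    -- any holomorphic eigenfunction for a principal eigenvalue lies in the Hardy space
    (∀ j : Fin n, ∀ f : (Fin n → ℂ) → ℂ,
      DifferentiableOn ℂ f (KoopmanHardy.polydisc n) →
      (∀ z ∈ KoopmanHardy.polydisc n,
        KoopmanHardy.koopmanGenerator F f z = lam j * f z) →
      f ∈ KoopmanHardy.hardySpace n) := by
  refine ⟨exists_linearizingConjugacy hflow hinv hstable hres, fun Ω ν hν j =>
    ⟨exists_isLeftEigenvector hstable j, fun w hw =>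
      ⟨exists_isPrincipalEigenfunction hflow hinv hstable hν hw, fun f hf => ?_⟩⟩,
    fun j f hf hgen => mem_hardySpace_of_koopmanGenerator_eq hflow hinv hf hgen⟩
  obtain ⟨hfd, hfφ⟩ := hf.differentiableOn_and_flow_eq hflow hinv hstable
    (hν.isOpen.mem_nhds hν.zero_mem) hν.isOpen hν.holomorphic
  have hflow_eq : ∀ t : ℝ, 0 ≤ t → ∀ z ∈ polydisc n,
      f (φ t z) = Complex.exp (lam j * t) * f z := by
    intro t ht z hz
    rw [hfφ z (Or.inl hz) t ht, ← mul_assoc, ← Complex.exp_add]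
    simp
  have hgen : ∀ z ∈ polydisc n, koopmanGenerator F f z = lam j * f z := by
    intro z hz
    rw [koopmanGenerator_apply]
    exact fderiv_eq_of_flow_eq hflow hz (hfd.differentiableAt ((isOpen_polydisc n).mem_nhds hz))
      fun s hs => hflow_eq s hs.1 z hz
  have hmem := mem_hardySpace_of_koopmanGenerator_eq hflow hinv hfd hgen
  refine ⟨hmem, hf.exists_ne_zero hν hw.1, ⟨hmem, ?_⟩, hgen, hflow_eq⟩
  -- On the polydisc `A_F f = λ f` inherits holomorphy and the flow relation from `f`, so the same
  -- Hardy space criterion applies to it.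
  have hAd : DifferentiableOn ℂ (koopmanGenerator F f) (polydisc n) :=
    (hfd.const_mul (lam j)).congr hgen
  refine mem_hardySpace_of_flow_eq (c := lam j) hflow hinv hAd fun z hz => ?_
  rw [hgen z hz, hgen _ (hflow.flow_mapsTo 1 zero_le_one hz), hfφ z (Or.inl hz) 1 zero_le_one]
  simp only [Complex.ofReal_one, mul_one]
  ring
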